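/- Write $\mathbb{Z}^{*}=\mathbb{Z}\setminus\{0\}$ and $a^{b}=b^{-1}ab$. Let $F=\langle x,y,z\rangle$ and $\tilde F=\langle\tilde x,\tilde y,\tilde z\rangle$ be free groups of rank $3$. For permutations $\rho,\theta$ of $\mathbb{Z}^{*}$ let $\mathcal{S}=\mathcal{S}_{\rho,\theta}\subset F$ be the set of all elements $$v_j^l=(x^{j}y^{-\rho(j)})^{z^{l}},\qquad w_j^l=(x^{j}zy^{-\theta(j)})^{z^{l}}\qquad (l\in\mathbb{Z},\ j\in\mathbb{Z}^{*}),$$ and let $H=\langle\mathcal{S}\rangle$; then $\mathcal{S}$ is a free basis of $H$. For permutations $\tilde\rho,\tilde\theta$ of $\mathbb{Z}^{*}$ define $\tilde v_j^l,\tilde w_j^l$, $\tilde{\mathcal{S}}$ and $\tilde H\le\tilde F$ in the same way from $\tilde x,\tilde y,\tilde z,\tilde\rho,\tilde\theta$. A bijection $\iota:\mathcal{S}\to\tilde{\mathcal{S}}$ extends to an isomorphism $\iota_*:H\to\tilde H$, and $G(\rho,\theta,\tilde\rho,\tilde\theta,\iota)$ denotes the amalgamated product of $F$ and $\tilde F$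 along $\iota_*:H\to\tilde H$. There are $2^{\aleph_0}$ pairwise non-isomorphic groups of the form $G(\rho,\theta,\tilde\rho,\tilde\theta,\iota)$ that are simple. More precisely, there exist partial bijections $\rho_{\mathrm{simple}},\tilde\rho_{\mathrm{simple}}$ of $\mathbb{Z}^{*}$ and a partial bijection $\iota_{\mathrm{simple}}$ from the set of symbols $v_j^l,w_j^l$ to the set of symbols $\tilde v_j^l,\tilde w_j^l$ ($l\in\mathbb{Z}$, $j\in\mathbb{Z}^*$), such that: 1. for each of the three, the complement of the domain and the complement of the image are countably infinite; 2. for every tuple $(\rho,\theta,\tilde\rho,\tilde\theta,\iota)$ as above such that $\rho,\tilde\rho,\iota$ extend $\rho_{\mathrm{simple}},\tilde\rho_{\mathrm{simple}},\iota_{\mathrm{simple}}$ respectively, the group $G(\rho,\theta,\tilde\rho,\tilde\theta,\iota)$ is simple; 3. there is a set of $2^{\aleph_0}$ tuples that extend $\rho_{\mathrm{simple}},\tilde\rho_{\mathrm{simple}},\iota_{\mathrm{simple}}$ in this sense, whose groups are simple and pairwise non-isomorphic. -/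

import Mathlib

namespace CammGroups

/-- The set `ℤ* = ℤ \ {0}`. -/
abbrev ZStar : Type := {n : ℤ // n ≠ 0}

/-- The free group of rank three; `F` and `F̃` are two copies of it. -/
abbrev F : Type := FreeGroup (Fin 3)

/-- The first free generator. -/
def x : F := FreeGroup.of 0

/-- The second free generator. -/
def y : F := FreeGroup.of 1

/-- The third free generator. -/
def z : F := FreeGroup.of 2

/-- Labels of the generators: `v l j` stands for `v_j^l` and `w l j` for `w_j^l`. -/
inductive Label : Type
  | v (l : ℤ) (j : ZStar)
  | w (l : ℤ) (j : ZStar)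

/-- The elements `v_j^l = (x^j y^{-ρ(j)})^{z^l}` and `w_j^l = (x^j z y^{-θ(j)})^{z^l}` of the free
group, where `a^b = b⁻¹ a b`. -/
def gen (ρ θ : Equiv.Perm ZStar) : Label → F
  | .v l j => (z ^ l)⁻¹ * (x ^ (j : ℤ) * y ^ (-(ρ j : ℤ))) * z ^ l
  | .w l j => (z ^ l)⁻¹ * (x ^ (j : ℤ) * z * y ^ (-(θ j : ℤ))) * z ^ l

/-- The set `S = {v_j^l, w_j^l | l ∈ ℤ, j ∈ ℤ*}`. -/
def S (ρ θ : Equiv.Perm ZStar) : Set F := Set.range (gen ρ θ)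

/-- The subgroup `H` generated by `S`. -/
def H (ρ θ : Equiv.Perm ZStar) : Subgroup F := Subgroup.closure (S ρ θ)

/-! `S` is a free basis of `H`: the free group acts (through `act`) on a set which is the cover
belonging to `H` with the free group on the labels attached to each vertex. -/

section Free

/-- A point `(k, l, j)` stands for `k z^l x^j`. -/
abbrev Pt : Type := FreeGroup Label × ℤ × ℤ

/-- Multiply the first coordinate by an element that depends on the other two. -/
def twist (a : ℤ × ℤ → FreeGroup Label) : Equiv.Perm Pt where
  toFun p := (p.1 * a p.2, p.2)
  invFun p := (p.1 * (a p.2)⁻¹, p.2)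
  left_inv p := by simp
  right_inv p := by simp

/-- Apply a permutation to the last coordinate. -/
def last (τ : Equiv.Perm ℤ) : Equiv.Perm Pt where
  toFun p := (p.1, p.2.1, τ p.2.2)
  invFun p := (p.1, p.2.1, τ.symm p.2.2)
  left_inv p := by simp
  right_inv p := by simp

/-- Move along the axis of `z`. -/
def axis : Equiv.Perm Pt where
  toFun p := (p.1, (if p.2.2 = 0 then p.2.1 + 1 else p.2.1), p.2.2)
  invFun p := (p.1, (if p.2.2 = 0 then p.2.1 - 1 else p.2.1), p.2.2)
  left_inv p := by
    obtain ⟨k, l, j⟩ := p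
    by_cases h : j = 0 <;> simp [h]
  right_inv p := by
    obtain ⟨k, l, j⟩ := p
    by_cases h : j = 0 <;> simp [h]

/-- The element attached to the `x`-coordinate `j` at level `l`. -/
def lab (c : ℤ → ZStar → Label) (q : ℤ × ℤ) : FreeGroup Label :=
  if h : q.2 ≠ 0 then FreeGroup.of (c (-q.1) ⟨q.2, h⟩) else 1

/-- From `x`-coordinates to `y`-coordinates. -/
def coord (ρ : Equiv.Perm ZStar) (c : ℤ → ZStar → Label) : Equiv.Perm Pt :=
  last (Equiv.Perm.ofSubtype ρ) * twist (lab c)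

/-- Right multiplication by `x`. -/
def actX : Equiv.Perm Pt := last (Equiv.addRight 1)

/-- Right multiplication by `y`. -/
def actY (ρ : Equiv.Perm ZStar) : Equiv.Perm Pt :=
  (coord ρ .v)⁻¹ * last (Equiv.addRight 1) * ((coord ρ .v)⁻¹)⁻¹

/-- Right multiplication by `z`. -/
def actZ (ρ θ : Equiv.Perm ZStar) : Equiv.Perm Pt :=
  (coord ρ .v)⁻¹ * coord θ .w * axis

/-- The action; `g` acts as right multiplication by `g⁻¹`. -/
def act (ρ θ : Equiv.Perm ZStar) : F →* Equiv.Perm Pt :=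
  FreeGroup.lift ![actX⁻¹, (actY ρ)⁻¹, (actZ ρ θ)⁻¹]

theorem last_zpow (n : ℤ) : (last (Equiv.addRight 1)) ^ n = last (Equiv.addRight n) := by
  have h1 : ∀ m : ℤ, last (Equiv.addRight (m + 1)) =
      last (Equiv.addRight m) * last (Equiv.addRight 1) := by
    intro m
    ext p
    · simp [last]
    · simp [last]
    · simp [last]; ring
  have h0 : last (Equiv.addRight 0) = 1 := by
    ext p <;> simp [last]
  induction n using Int.induction_on with
  | zero => rw [h0, zpow_zero]
  | succ i ih => rw [zpow_add_one, ih, h1]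
  | pred i ih =>
    rw [zpow_sub_one, ih, mul_inv_eq_iff_eq_mul, ← h1]
    simp

theorem coord_zero (ρ : Equiv.Perm ZStar) (c : ℤ → ZStar → Label) (k : FreeGroup Label) (l : ℤ) :
    coord ρ c (k, l, 0) = (k, l, 0) := by
  have : Equiv.Perm.ofSubtype ρ (0 : ℤ) = 0 :=
    Equiv.Perm.ofSubtype_apply_of_not_mem ρ (by simp)
  simp [coord, last, twist, lab, this]

theorem coord_ne (ρ : Equiv.Perm ZStar) (c : ℤ → ZStar → Label) (k : FreeGroup Label) (l : ℤ)
    (j : ZStar) : coord ρ c (k, l, (j : ℤ)) = (k * FreeGroup.of (c (-l) j), l, (ρ j : ℤ)) := by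
  simp [coord, last, twist, lab, j.2]

theorem actX_zpow (n : ℤ) (k : FreeGroup Label) (l j : ℤ) :
    (actX ^ n) (k, l, j) = (k, l, j + n) := by
  rw [actX, last_zpow]; rfl

theorem actZ_zpow (ρ θ : Equiv.Perm ZStar) (n : ℤ) (k : FreeGroup Label) (l : ℤ) :
    (actZ ρ θ ^ n) (k, l, 0) = (k, l + n, 0) := by
  have h1 : ∀ m : ℤ, actZ ρ θ (k, m, 0) = (k, m + 1, 0) := by
    intro m
    have : axis (k, m, 0) = (k, m + 1, 0) := by simp [axis]
    rw [actZ, Equiv.Perm.mul_apply, Equiv.Perm.mul_apply, this, coord_zero,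
      Equiv.Perm.inv_eq_iff_eq, coord_zero]
  induction n using Int.induction_on generalizing l with
  | zero => simp
  | succ i ih =>
    rw [zpow_add_one, Equiv.Perm.mul_apply, h1, ih]
    congr 2; ring
  | pred i ih =>
    rw [zpow_sub_one, Equiv.Perm.mul_apply]
    have : (actZ ρ θ)⁻¹ (k, l, 0) = (k, l - 1, 0) := by
      rw [Equiv.Perm.inv_eq_iff_eq, h1]; simp
    rw [this, ih]
    congr 2; ring

theorem actY_zpow (ρ : Equiv.Perm ZStar) (n : ℤ) :
    actY ρ ^ n = (coord ρ .v)⁻¹ * last (Equiv.addRight n) * coord ρ .v := by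
  rw [actY, conj_zpow, last_zpow, inv_inv]

theorem act_gen (ρ θ : Equiv.Perm ZStar) (a : Label) (k : FreeGroup Label) :
    act ρ θ (gen ρ θ a) (k, 0, 0) = (k * (FreeGroup.of a)⁻¹, 0, 0) := by
  have hx : act ρ θ x = actX⁻¹ := by simp [act, x]
  have hy : act ρ θ y = (actY ρ)⁻¹ := by simp [act, y]
  have hz : act ρ θ z = (actZ ρ θ)⁻¹ := by simp [act, z]
  suffices h : (act ρ θ (gen ρ θ a))⁻¹ (k * (FreeGroup.of a)⁻¹, 0, 0) = (k, 0, 0) by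
    rw [Equiv.Perm.inv_eq_iff_eq] at h
    exact h.symm
  have key : ∀ (m : ℤ) (k' : FreeGroup Label) (l : ℤ),
      (actY ρ ^ (-m)) ((coord ρ .v)⁻¹ (k', l, m)) = (k', l, 0) := by
    intro m k' l
    rw [actY_zpow]
    have hcc : coord ρ .v ((coord ρ .v)⁻¹ (k', l, m)) = (k', l, m) :=
      (coord ρ .v).apply_symm_apply _
    rw [Equiv.Perm.mul_apply, Equiv.Perm.mul_apply, hcc, Equiv.Perm.inv_eq_iff_eq, coord_zero]
    simp [last]
  have hpt : ∀ p : Pt, (coord ρ .v)⁻¹ (coord ρ .v p) = p := fun p =>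
    (coord ρ .v).symm_apply_apply p
  cases a with
  | v l j =>
    simp only [gen, map_mul, map_zpow, hx, hy, hz, mul_inv_rev, inv_zpow,
      ← zpow_neg, neg_neg, Equiv.Perm.mul_apply]
    rw [actZ_zpow, actX_zpow, zero_add, zero_add, ← hpt (_, _, (j : ℤ)), coord_ne, key, actZ_zpow]
    simp
  | w l j =>
    simp only [gen, map_mul, map_zpow, hx, hy, hz, mul_inv_rev, inv_zpow, inv_inv,
      ← zpow_neg, neg_neg, Equiv.Perm.mul_apply]
    have hax : ∀ k' (l' : ℤ), axis (k', l', (j : ℤ)) = (k', l', (j : ℤ)) := by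
      intro k' l'; simp [axis, j.2]
    rw [actZ_zpow, actX_zpow, zero_add, zero_add, actZ, Equiv.Perm.mul_apply,
      Equiv.Perm.mul_apply, hax, coord_ne, key, ← actZ, actZ_zpow]
    simp

theorem act_lift (ρ θ : Equiv.Perm ZStar) (u : FreeGroup Label) :
    ∀ k : FreeGroup Label,
      act ρ θ (FreeGroup.lift (gen ρ θ) u) (k, 0, 0) = (k * u⁻¹, 0, 0) := by
  induction u using FreeGroup.induction_on with
  | C1 => intro k; simp
  | of a => intro k; rw [FreeGroup.lift_apply_of, act_gen]
  | inv_of a h =>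
    intro k
    rw [map_inv, map_inv, Equiv.Perm.inv_eq_iff_eq, h]
    simp
  | mul a b ha hb =>
    intro k
    rw [map_mul, map_mul, Equiv.Perm.mul_apply, hb, ha]
    simp [mul_assoc]

/-- The generators `v_j^l`, `w_j^l` are free generators. -/
theorem lift_gen_injective (ρ θ : Equiv.Perm ZStar) :
    Function.Injective (FreeGroup.lift (gen ρ θ)) := by
  intro u u' h
  have h1 := act_lift ρ θ u 1
  rw [h, act_lift] at h1
  simpa using (congrArg Prod.fst h1).symm

theorem gen_injective (ρ θ : Equiv.Perm ZStar) : Function.Injective (gen ρ θ) := by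
  intro a b h
  apply FreeGroup.of_injective
  apply lift_gen_injective ρ θ
  simpa using h

theorem lift_S_injective (ρ θ : Equiv.Perm ZStar) :
    Function.Injective (FreeGroup.lift (Subtype.val : S ρ θ → F)) := by
  let e : Label ≃ S ρ θ := Equiv.ofInjective _ (gen_injective ρ θ)
  have h : (FreeGroup.lift (Subtype.val : S ρ θ → F)) =
      (FreeGroup.lift (gen ρ θ)).comp (FreeGroup.freeGroupCongr e.symm).toMonoidHom := by
    apply FreeGroup.ext_hom
    intro s
    obtain ⟨a, rfl⟩ := e.surjective s
    change FreeGroup.lift (Subtype.val : S ρ θ → F) (FreeGroup.of (e a)) =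
      FreeGroup.lift (gen ρ θ) (FreeGroup.freeGroupCongr e.symm (FreeGroup.of (e a)))
    rw [FreeGroup.lift_apply_of, FreeGroup.freeGroupCongr_apply, FreeGroup.map.of,
      FreeGroup.lift_apply_of, e.symm_apply_apply]
    rfl
  rw [h]
  exact (lift_gen_injective ρ θ).comp (FreeGroup.freeGroupCongr e.symm).injective

end Free

/-- The isomorphism from the free group on the set `S` to `H` which is the identity on `S`. -/
noncomputable def freeIso (ρ θ : Equiv.Perm ZStar) : FreeGroup (S ρ θ) ≃* H ρ θ :=
  (MonoidHom.ofInjective (lift_S_injective ρ θ)).trans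
    (MulEquiv.subgroupCongr (by
      rw [FreeGroup.range_lift_eq_closure, Subtype.range_coe]; rfl))

theorem freeIso_of (ρ θ : Equiv.Perm ZStar) (s : S ρ θ) :
    ((freeIso ρ θ (FreeGroup.of s) : H ρ θ) : F) = s := by
  change FreeGroup.lift (Subtype.val : S ρ θ → F) (FreeGroup.of s) = s
  rw [FreeGroup.lift_apply_of]

/-- The tuples `ω = (ρ, θ, ρ̃, θ̃, ι)`: four permutations of `ℤ*` and a bijection `ι` from
`S_{ρ,θ}` to `S̃_{ρ̃,θ̃}`. -/
structure Param : Type where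
  ρ : Equiv.Perm ZStar
  θ : Equiv.Perm ZStar
  ρt : Equiv.Perm ZStar
  θt : Equiv.Perm ZStar
  ι : S ρ θ ≃ S ρt θt

/-- The isomorphism `ι* : H → H̃` that extends `ι`. -/
noncomputable def edgeIso (ω : Param) : H ω.ρ ω.θ ≃* H ω.ρt ω.θt :=
  ((freeIso ω.ρ ω.θ).symm.trans (FreeGroup.freeGroupCongr ω.ι)).trans (freeIso ω.ρt ω.θt)

theorem edgeIso_apply (ω : Param) (s : S ω.ρ ω.θ) :
    ((edgeIso ω ⟨s, Subgroup.subset_closure s.2⟩ : H ω.ρt ω.θt) : F) = ω.ι s := by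
  have h : (⟨s, Subgroup.subset_closure s.2⟩ : H ω.ρ ω.θ) = freeIso ω.ρ ω.θ (FreeGroup.of s) :=
    Subtype.ext (freeIso_of ω.ρ ω.θ s).symm
  rw [h]
  simp [edgeIso, freeIso_of]

/-- The two embeddings of the edge group `H`: the inclusion in `F` (index `false`), and `ι*`
followed by the inclusion of `H̃` in `F̃` (index `true`). -/
noncomputable def edgeMap (ω : Param) : (i : Bool) → H ω.ρ ω.θ →* (fun _ : Bool => F) i
  | false => (H ω.ρ ω.θ).subtype
  | true => (H ω.ρt ω.θt).subtype.comp (edgeIso ω).toMonoidHom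

/-- The group `G(ρ, θ, ρ̃, θ̃, ι)`: the amalgamated product of `F` and `F̃` with respect to
`ι* : H → H̃`. -/
abbrev G (ω : Param) : Type := Monoid.PushoutI (edgeMap ω)

/-- The element of `S` with a given label. -/
def genS (ρ θ : Equiv.Perm ZStar) (a : Label) : S ρ θ := ⟨gen ρ θ a, a, rfl⟩

/-- The maps `ρ`, `ρ̃`, `ι` of the tuple extend given partial bijections `r`, `rt` of `ℤ*` and `i`
from `S` to `S̃`, the last one being given by its effect on labels. -/
def Param.Extends (ω : Param) (r rt : ZStar ≃. ZStar) (i : Label ≃. Label) : Prop :=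
  (∀ a b, b ∈ r a → ω.ρ a = b) ∧ (∀ a b, b ∈ rt a → ω.ρt a = b) ∧
    ∀ a b, b ∈ i a → ω.ι (genS ω.ρ ω.θ a) = genS ω.ρt ω.θt b

/-- The complements of the domain and of the image of a partial bijection are countably
infinite. -/
def CoInfinite {α β : Type} (f : α ≃. β) : Prop :=
  ({a | f a = none}.Infinite ∧ {a | f a = none}.Countable) ∧
    ({b | f.symm b = none}.Infinite ∧ {b | f.symm b = none}.Countable)

end CammGroups

namespace CammGroups

/-! Simplicity is reduced to a combinatorial condition `IsRich` on ρ, ρ̃ and ι alone, every clause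
of which is witnessed by finitely many values. Partial bijections containing all the witnesses are
then built generically, and the remaining freedom in ι gives the continuum of groups.

The elements z^l x^n represent all cosets of H. Right multiplication by v_m moves the coset of x^i
to that of x^j when ρ(m+i) = ρ(m) + ρ(j), so a rich ρ realises any finite partial injection of the
representatives x^i as the effect of some v_m. Conjugation by z shifts superscripts; a rich ι sends
shifts of any finite set of labels to shifts of any prescribed distinct labels. Hence a normal
subgroup N containing a word in the generators also contains, on the other side, the word with its
letters renamed injectively (`edge_map_mem`).

Let N be a nontrivial normal subgroup. If g in N is not in H, conjugation by g carries suitable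
u₁u₂⁻¹ in H to different elements of H, so N meets H nontrivially (`exists_edge_mem`). Rename the
letters of a word w ≠ 1 so that they act on cosets like the regular representation of a free group:
some conjugate then lies in a factor and outside its copy of H (`exists_mem_notMem_range`). A
commutator of such an element with a generator is a word of H in which that generator occurs once;
replacing it by a fresh one identifies two generators modulo N (`exists_mul_inv_mem`). By renaming,
all generators become equal, and this kills x, y and z.

The clauses of `IsRich` amount to countably many requirements, each attainable from any finite
piece, while infinitely many elements are kept out of the domains and images (`exists_generic`).
Finally, a countable group is isomorphic to the groups of only countably many ι, since the images of
the six generators determine ι; there are 2^ℵ₀ choices of ι. -/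

theorem infinite_zStar : Infinite ZStar :=
  Infinite.of_injective (fun n : ℕ => (⟨(n : ℤ) + 1, by omega⟩ : ZStar)) fun a b h => by
    simpa using congrArg Subtype.val h

theorem countable_label : Countable Label := by
  refine Function.Injective.countable
    (f := fun a : Label => match a with
      | .v l j => (Sum.inl (l, j) : (ℤ × ZStar) ⊕ (ℤ × ZStar))
      | .w l j => Sum.inr (l, j)) ?_
  rintro (⟨l, j⟩ | ⟨l, j⟩) (⟨l', j'⟩ | ⟨l', j'⟩) h <;> simp_all

theorem infinite_label : Infinite Label :=
  Infinite.of_injective (fun n : ℤ => Label.v n ⟨1, one_ne_zero⟩) fun a b h => by simpa using h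

attribute [instance] infinite_zStar countable_label infinite_label

/-! ### Shifts of superscripts and powers of x modulo H. -/

/-- Add `l` to the superscript. -/
def shift (l : ℤ) : Label → Label
  | .v i j => .v (i + l) j
  | .w i j => .w (i + l) j

theorem shift_injective (l : ℤ) : Function.Injective (shift l) := by
  rintro (⟨i, j⟩ | ⟨i, j⟩) (⟨i', j'⟩ | ⟨i', j'⟩) h <;> simp_all [shift]

theorem shift_left_injective (a : Label) : Function.Injective fun l => shift l a := by
  intro l l' h
  cases a <;> simpa [shift] using h

theorem gen_shift (ρ θ : Equiv.Perm ZStar) (l : ℤ) (a : Label) :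
    gen ρ θ (shift l a) = (z ^ l)⁻¹ * gen ρ θ a * z ^ l := by
  cases a <;> simp only [gen, shift, zpow_add] <;> group

theorem lift_gen_shift (ρ θ : Equiv.Perm ZStar) (l : ℤ) (u : FreeGroup Label) :
    FreeGroup.lift (gen ρ θ) (FreeGroup.map (shift l) u) =
      (z ^ l)⁻¹ * FreeGroup.lift (gen ρ θ) u * z ^ l := by
  induction u using FreeGroup.induction_on with
  | C1 => simp
  | of a => simp [gen_shift]
  | inv_of a _ => simp [gen_shift, mul_assoc]
  | mul a b ha hb => rw [map_mul, map_mul, ha, hb, map_mul]; group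

/-- Distinct powers of x lie in distinct cosets of H: under `act`, elements of H keep the last
coordinate of the base point equal to 0, while x^n changes it by -n. -/
theorem eq_zero_of_lift_gen_eq {ρ θ : Equiv.Perm ZStar} {u : FreeGroup Label} {n : ℤ}
    (h : FreeGroup.lift (gen ρ θ) u = x ^ n) : n = 0 := by
  have h1 := act_lift ρ θ u 1
  have hx : act ρ θ x = actX⁻¹ := by simp [act, x]
  rw [h, map_zpow, hx, inv_zpow, ← zpow_neg, actX_zpow] at h1
  simpa using (congrArg (fun p : Pt => p.2.2) h1)

/-! ### Coset representatives of H. -/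

section Coset

variable (ρ θ : Equiv.Perm ZStar)

/-- The elements `h z^l x^n` with `h ∈ H`. -/
def cosets : Set F :=
  {f | ∃ (u : FreeGroup Label) (l n : ℤ), f = FreeGroup.lift (gen ρ θ) u * z ^ l * x ^ n}

variable {ρ θ}

theorem lift_mul_mem_cosets (u : FreeGroup Label) {f : F} (hf : f ∈ cosets ρ θ) :
    FreeGroup.lift (gen ρ θ) u * f ∈ cosets ρ θ := by
  obtain ⟨u', l, n, rfl⟩ := hf
  exact ⟨u * u', l, n, by simp [mul_assoc]⟩

theorem zpow_mul_mem_cosets (l : ℤ) {f : F} (hf : f ∈ cosets ρ θ) :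
    z ^ l * f ∈ cosets ρ θ := by
  obtain ⟨u', l', n, rfl⟩ := hf
  refine ⟨FreeGroup.map (shift (-l)) u', l + l', n, ?_⟩
  rw [lift_gen_shift, zpow_add]
  group

theorem gen_mul_mem_cosets (a : Label) {f : F} (hf : f ∈ cosets ρ θ) :
    gen ρ θ a * f ∈ cosets ρ θ := by
  simpa using lift_mul_mem_cosets (FreeGroup.of a) hf

theorem gen_inv_mul_mem_cosets (a : Label) {f : F} (hf : f ∈ cosets ρ θ) :
    (gen ρ θ a)⁻¹ * f ∈ cosets ρ θ := by
  simpa using lift_mul_mem_cosets (FreeGroup.of a)⁻¹ hf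

theorem x_zpow_mem_cosets (n : ℤ) : x ^ n ∈ cosets ρ θ := ⟨1, 0, n, by simp⟩

/-- Surjectivity of ρ enters here: for k ≠ 0 some v_j joins the coset of y^k to that of x^j, where
ρ(j) = k. -/
theorem y_zpow_mem_cosets (k : ℤ) : y ^ k ∈ cosets ρ θ := by
  rcases eq_or_ne k 0 with rfl | hk
  · simpa using x_zpow_mem_cosets 0
  · have : y ^ k = (gen ρ θ (.v 0 (ρ.symm ⟨k, hk⟩)))⁻¹ * x ^ (ρ.symm ⟨k, hk⟩ : ℤ) := by
      simp [gen]
    rw [this]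
    exact gen_inv_mul_mem_cosets _ (x_zpow_mem_cosets _)

theorem x_zpow_mul_y_zpow_mem_cosets (n k : ℤ) : x ^ n * y ^ k ∈ cosets ρ θ := by
  rcases eq_or_ne n 0 with rfl | hn
  · simpa using y_zpow_mem_cosets k
  · have : x ^ n * y ^ k = gen ρ θ (.v 0 ⟨n, hn⟩) * y ^ ((ρ ⟨n, hn⟩ : ℤ) + k) := by
      simp [gen, zpow_add, mul_assoc]
    rw [this]
    exact gen_mul_mem_cosets _ (y_zpow_mem_cosets _)

theorem x_zpow_mul_z_mem_cosets (n : ℤ) : x ^ n * z ∈ cosets ρ θ := by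
  rcases eq_or_ne n 0 with rfl | hn
  · exact ⟨1, 1, 0, by simp⟩
  · have : x ^ n * z = gen ρ θ (.w 0 ⟨n, hn⟩) * y ^ (θ ⟨n, hn⟩ : ℤ) := by
      simp [gen]
    rw [this]
    exact gen_mul_mem_cosets _ (y_zpow_mem_cosets _)

theorem y_zpow_mul_z_inv_mem_cosets (k : ℤ) : y ^ k * z⁻¹ ∈ cosets ρ θ := by
  rcases eq_or_ne k 0 with rfl | hk
  · exact ⟨1, -1, 0, by simp⟩
  · have : y ^ k * z⁻¹ = (gen ρ θ (.w 0 (θ.symm ⟨k, hk⟩)))⁻¹ * x ^ (θ.symm ⟨k, hk⟩ : ℤ) := by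
      simp [gen, mul_assoc]
    rw [this]
    exact gen_inv_mul_mem_cosets _ (x_zpow_mem_cosets _)

theorem x_zpow_mul_z_inv_mem_cosets (n : ℤ) : x ^ n * z⁻¹ ∈ cosets ρ θ := by
  rcases eq_or_ne n 0 with rfl | hn
  · exact ⟨1, -1, 0, by simp⟩
  · have : x ^ n * z⁻¹ =
        gen ρ θ (.v 0 ⟨n, hn⟩) * (y ^ (ρ ⟨n, hn⟩ : ℤ) * z⁻¹) := by
      simp [gen, mul_assoc]
    rw [this]
    exact gen_mul_mem_cosets _ (y_zpow_mul_z_inv_mem_cosets _)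

variable (ρ θ) in
/-- The elements `z^l x^n` represent all the cosets of `H`. -/
theorem exists_eq_lift_mul (f : F) : f ∈ cosets ρ θ := by
  suffices h : ∀ g ∈ cosets ρ θ, g * f ∈ cosets ρ θ by
    simpa using h 1 ⟨1, 0, 0, by simp⟩
  -- Elements of H are absorbed on the left and z normalises H, so only the products x^n s have to
  -- be examined.
  have key : ∀ s : F, (∀ n : ℤ, x ^ n * s ∈ cosets ρ θ) →
      ∀ g ∈ cosets ρ θ, g * s ∈ cosets ρ θ := by
    rintro s hs _ ⟨u, l, n, rfl⟩
    rw [mul_assoc, mul_assoc]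
    exact lift_mul_mem_cosets u (zpow_mul_mem_cosets l (hs n))
  induction f using FreeGroup.induction_on with
  | C1 => simp
  | of i =>
    refine key _ fun n => ?_
    fin_cases i
    · exact ⟨1, 0, n + 1, by simp [zpow_add, x]⟩
    · simpa [y] using x_zpow_mul_y_zpow_mem_cosets (ρ := ρ) (θ := θ) n 1
    · exact x_zpow_mul_z_mem_cosets n
  | inv_of i _ =>
    refine key _ fun n => ?_
    fin_cases i
    · exact ⟨1, 0, n - 1, by simp [zpow_sub, x]⟩
    · simpa [y] using x_zpow_mul_y_zpow_mem_cosets (ρ := ρ) (θ := θ) n (-1)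
    · exact x_zpow_mul_z_inv_mem_cosets n
  | mul a b ha hb =>
    intro g hg
    rw [← mul_assoc]
    exact hb _ (ha _ hg)

end Coset

/-! ### The generators acting on cosets. -/

/-- Right multiplication by `v_m^0` moves the coset of `x^i` to the coset of `x^j`. -/
theorem x_zpow_mul_gen_v {ρ : Equiv.Perm ZStar} (θ : Equiv.Perm ZStar) {m m' i j : ZStar}
    (hm : (m' : ℤ) = m + i) (h : (ρ m' : ℤ) = ρ m + ρ j) :
    x ^ (i : ℤ) * gen ρ θ (.v 0 m) =
      gen ρ θ (.v 0 m') * (gen ρ θ (.v 0 j))⁻¹ * x ^ (j : ℤ) := by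
  simp only [gen, hm, h]
  group

/-- Right multiplication by `v_m^0` moves the coset of `z^l x^i` to the coset of `z^l x^j`. -/
theorem zpow_mul_zpow_mul_gen_v {ρ : Equiv.Perm ZStar} (θ : Equiv.Perm ZStar) (l : ℤ)
    {m m' i j : ZStar} (hm : (m' : ℤ) = m + i) (h : (ρ m' : ℤ) = ρ m + ρ j) :
    z ^ l * x ^ (i : ℤ) * gen ρ θ (.v 0 m) =
      gen ρ θ (.v (-l) m') * (gen ρ θ (.v (-l) j))⁻¹ * (z ^ l * x ^ (j : ℤ)) := by
  simp only [gen, hm, h]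
  group

/-- Multiplying z^l x^n by v_m gives v_{m+n}^{-l} z^l y^δ with δ = ρ(m+n) - ρ(m). If q has the same
δ, multiplying by v_q⁻¹ afterwards leads back to the coset of z^l x^n. -/
theorem zpow_mul_zpow_mul_gen_v_mul_inv {ρ : Equiv.Perm ZStar} (θ : Equiv.Perm ZStar) {l n : ℤ}
    {m m' q q' : ZStar} (hm : (m' : ℤ) = m + n) (hq : (q' : ℤ) = q + n)
    (h : (ρ m' : ℤ) - ρ m = ρ q' - ρ q) :
    z ^ l * x ^ n * (gen ρ θ (.v 0 m) * (gen ρ θ (.v 0 q))⁻¹) =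
      gen ρ θ (.v (-l) m') * (gen ρ θ (.v (-l) q'))⁻¹ * (z ^ l * x ^ n) := by
  have h' : (ρ m' : ℤ) = ρ m + (ρ q' - ρ q) := by omega
  simp only [gen, hm, hq, h']
  group


/-! ### The combinatorial condition for simplicity. -/

/-- The relation on labels used to conjugate `u₁ u₂⁻¹` along a path: at each step `v_m^0` is
replaced by `v_{m+n}^{-l}`, and the result is carried to the other side. -/
inductive Chain (r : Bool → ZStar → ZStar → Prop) (t : Bool → Label → Label → Prop) :
    Bool → List (ℤ × ℤ) → Label → Label → Prop
  | nil (b : Bool) (u : Label) : Chain r t b [] u u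
  | cons {b : Bool} {n l : ℤ} {c : List (ℤ × ℤ)} {m m' : ZStar} {u u' : Label}
      (hm : (m' : ℤ) = m + n)
      -- Normalising the increment of ρ to 1 when n ≠ 0 gives two chains along the same path equal
      -- increments, as conjugation of u₁u₂⁻¹ requires.
      (h : n = 0 ∨ ∃ k k' : ZStar, r b m k ∧ r b m' k' ∧ (k' : ℤ) = k + 1)
      (ht : t b (.v (-l) m') u) (hc : Chain r t (!b) c u u') :
      Chain r t b ((n, l) :: c) (.v 0 m) u'

theorem Chain.mono {r r' : Bool → ZStar → ZStar → Prop} {t t' : Bool → Label → Label → Prop}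
    (hr : ∀ b m k, r b m k → r' b m k) (ht : ∀ b a a', t b a a' → t' b a a')
    {b : Bool} {c : List (ℤ × ℤ)} {u u' : Label} (h : Chain r t b c u u') :
    Chain r' t' b c u u' := by
  induction h with
  | nil b u => exact .nil b u
  | cons hm h h2 _ ih =>
    refine .cons hm ?_ (ht _ _ _ h2) ih
    exact h.imp_right fun ⟨k, k', h1, h2, h3⟩ => ⟨k, k', hr _ _ _ h1, hr _ _ _ h2, h3⟩

/-- The combinatorial properties of the permutations which make the group simple. -/
structure IsRich (R : Bool → Equiv.Perm ZStar) (T : Bool → Label ≃ Label) : Prop where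
  exists_line : ∀ (b : Bool) (κ : List (ZStar × ZStar)), (κ.map Prod.fst).Nodup →
    (κ.map Prod.snd).Nodup → ∀ A : Finset ZStar, ∃ m ∉ A, ∀ q ∈ κ, ∃ m' : ZStar,
      (m' : ℤ) = m + q.1 ∧ (R b m' : ℤ) = R b m + q.2
  exists_shift : ∀ ps : List (Label × Label), (ps.map Prod.fst).Nodup → (ps.map Prod.snd).Nodup →
    ∃ l l' : ℤ, ∀ q ∈ ps, T false (shift l q.1) = shift l' q.2
  exists_chain : ∀ (b : Bool) (c : List (ℤ × ℤ)), c ≠ [] → (∀ q ∈ c, q ≠ (0, 0)) →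
    ∀ A : Finset Label, ∃ u u' : Label, u ∉ A ∧
      Chain (fun b m k => R b m = k) (fun b a a' => T b a = a') b c u u' ∧ u' ≠ u ∧ u' ≠ T b u

/-- `Γ` is generated by two copies of `F` in which the generators of the two subgroups `H` are
identified along `T`. -/
structure IsAmalgam {Γ : Type} [Group Γ] (R Θ : Bool → Equiv.Perm ZStar)
    (T : Bool → Label ≃ Label) (φ : Bool → F →* Γ) : Prop where
  injective : ∀ b, Function.Injective (φ b)
  symm_apply : ∀ b a, T (!b) (T b a) = a
  compat : ∀ b a, φ b (gen (R b) (Θ b) a) = φ (!b) (gen (R !b) (Θ !b) (T b a))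
  eq_top : ∀ N : Subgroup Γ, (∀ b f, φ b f ∈ N) → N = ⊤

theorem exists_map_congr (w : FreeGroup Label) : ∃ A : Finset Label,
    ∀ (β : Type) (f g : Label → FreeGroup β), (∀ a ∈ A, f a = g a) →
      FreeGroup.lift f w = FreeGroup.lift g w := by
  classical
  induction w using FreeGroup.induction_on with
  | C1 => exact ⟨∅, by simp⟩
  | of a => exact ⟨{a}, by simp⟩
  | inv_of a _ => exact ⟨{a}, by simp⟩
  | mul a b ha hb =>
    obtain ⟨A, hA⟩ := ha
    obtain ⟨B, hB⟩ := hb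
    refine ⟨A ∪ B, fun β f g h => ?_⟩
    rw [map_mul, map_mul, hA β f g fun a ha => h a (by simp [ha]),
      hB β f g fun a ha => h a (by simp [ha])]

/-- A finite set that contains the letters of `w`. -/
noncomputable def letters (w : FreeGroup Label) : Finset Label := (exists_map_congr w).choose

theorem map_congr_of_letters {w : FreeGroup Label} {f g : Label → Label}
    (h : ∀ a ∈ letters w, f a = g a) : FreeGroup.map f w = FreeGroup.map g w := by
  rw [FreeGroup.map_eq_lift, FreeGroup.map_eq_lift]
  exact (exists_map_congr w).choose_spec Label _ _ fun a ha => by simp [h a ha]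

/-- A greedy choice: every new value is taken outside the finite set of earlier ones. -/
theorem exists_injOn_choice {α β : Type} [Nonempty β] (s : Finset α) {P : α → β → Prop}
    (h : ∀ a ∈ s, ∀ A : Finset β, ∃ b ∉ A, P a b) :
    ∃ f : α → β, Set.InjOn f s ∧ ∀ a ∈ s, P a (f a) := by
  classical
  induction s using Finset.induction_on with
  | empty => exact ⟨fun _ => Classical.arbitrary β, by simp⟩
  | insert a s ha ih =>
    obtain ⟨f, hf, hP⟩ := ih fun a' ha' => h a' (by simp [ha'])
    obtain ⟨b, hb, hPb⟩ := h a (by simp) (s.image f)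
    have hne : ∀ a' ∈ s, a' ≠ a := fun a' ha' e => ha (e ▸ ha')
    refine ⟨Function.update f a b, ?_, ?_⟩
    · intro c hc d hd hcd
      simp only [Finset.coe_insert, Set.mem_insert_iff, Finset.mem_coe] at hc hd
      simp only [Finset.mem_image, not_exists, not_and] at hb
      rcases hc with rfl | hc <;> rcases hd with rfl | hd
      · rfl
      · rw [Function.update_self, Function.update_of_ne (hne d hd)] at hcd
        exact absurd hcd.symm (hb d hd)
      · rw [Function.update_self, Function.update_of_ne (hne c hc)] at hcd
        exact absurd hcd (hb c hc)
      · rw [Function.update_of_ne (hne c hc), Function.update_of_ne (hne d hd)] at hcd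
        exact hf hc hd hcd
    · intro c hc
      rcases Finset.mem_insert.1 hc with rfl | hc
      · simpa using hPb
      · rw [Function.update_of_ne (hne c hc)]
        exact hP c hc

/-! ### Alternating products in an amalgam. -/

section Amalgam

variable {Γ : Type} [Group Γ] {R Θ : Bool → Equiv.Perm ZStar} {T : Bool → Label ≃ Label}
  {φ : Bool → F →* Γ}

variable (R Θ φ) in
/-- The embedding of the free group on the labels given by the generators on the side `b`. -/
def edge (b : Bool) : FreeGroup Label →* Γ := (φ b).comp (FreeGroup.lift (gen (R b) (Θ b)))

theorem edge_apply (b : Bool) (u : FreeGroup Label) :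
    edge R Θ φ b u = φ b (FreeGroup.lift (gen (R b) (Θ b)) u) := rfl

theorem edge_of (b : Bool) (a : Label) :
    edge R Θ φ b (.of a) = φ b (gen (R b) (Θ b) a) := by simp [edge]

theorem edge_map_shift (b : Bool) (l : ℤ) (u : FreeGroup Label) :
    edge R Θ φ b (FreeGroup.map (shift l) u) = (φ b z ^ l)⁻¹ * edge R Θ φ b u * φ b z ^ l := by
  simp [edge, lift_gen_shift]

namespace IsAmalgam

theorem edge_eq (hΓ : IsAmalgam R Θ T φ) (b : Bool) (u : FreeGroup Label) :
    edge R Θ φ b u = edge R Θ φ (!b) (FreeGroup.map (T b) u) := by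
  have : edge R Θ φ b = (edge R Θ φ (!b)).comp (FreeGroup.map (T b)) := by
    ext a
    simp [edge_of, hΓ.compat b a]
  exact DFunLike.congr_fun this u

end IsAmalgam

/-- The alternating products of elements outside the two subgroups `H`, the first factor being
on the side `b`. -/
inductive Alternating (R Θ : Bool → Equiv.Perm ZStar) (φ : Bool → F →* Γ) : Bool → Γ → Prop
  | single (b : Bool) (f : F) (hf : f ∉ (FreeGroup.lift (gen (R b) (Θ b))).range) :
      Alternating R Θ φ b (φ b f)
  | cons (b : Bool) (f : F) (hf : f ∉ (FreeGroup.lift (gen (R b) (Θ b))).range) (g : Γ)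
      (hg : Alternating R Θ φ (!b) g) : Alternating R Θ φ b (φ b f * g)

/-- An element of H can be rewritten on either side, so the first factor absorbs it. -/
theorem Alternating.edge_mul (hΓ : IsAmalgam R Θ T φ) {b : Bool} {g : Γ}
    (hg : Alternating R Θ φ b g) (b' : Bool) (u : FreeGroup Label) :
    Alternating R Θ φ b (edge R Θ φ b' u * g) := by
  wlog hb : b' = b generalizing b' u
  · have hb' : (!b') = b := by cases b <;> cases b' <;> simp_all
    rw [hΓ.edge_eq]
    exact this (!b') _ hb'
  subst hb
  cases hg with
  | single _ f hf =>
    rw [edge_apply, ← map_mul]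
    refine .single _ _ fun h => hf ?_
    exact (mul_mem_cancel_left (MonoidHom.mem_range.2 ⟨u, rfl⟩)).1 h
  | cons _ f hf g hg =>
    rw [edge_apply, ← mul_assoc, ← map_mul]
    refine .cons _ _ (fun h => hf ?_) _ hg
    exact (mul_mem_cancel_left (MonoidHom.mem_range.2 ⟨u, rfl⟩)).1 h

variable (R Θ φ) in
/-- The elements that are in `H` or alternating. -/
def normalForms : Set Γ :=
  {g | (∃ u, g = edge R Θ φ false u) ∨ ∃ b, Alternating R Θ φ b g}

theorem IsAmalgam.edge_mem_normalForms (hΓ : IsAmalgam R Θ T φ) (b : Bool) (u : FreeGroup Label) :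
    edge R Θ φ b u ∈ normalForms R Θ φ := by
  cases b
  · exact .inl ⟨u, rfl⟩
  · exact .inl ⟨_, hΓ.edge_eq _ _⟩

theorem IsAmalgam.edge_mul_mem_normalForms (hΓ : IsAmalgam R Θ T φ) (b : Bool)
    (u : FreeGroup Label) {g : Γ} (hg : g ∈ normalForms R Θ φ) :
    edge R Θ φ b u * g ∈ normalForms R Θ φ := by
  rcases hg with ⟨u', rfl⟩ | ⟨b', hg⟩
  · cases b
    · rw [← map_mul]
      exact hΓ.edge_mem_normalForms _ _
    · rw [hΓ.edge_eq, Bool.not_true, ← map_mul]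
      exact hΓ.edge_mem_normalForms _ _
  · exact .inr ⟨b', hg.edge_mul hΓ _ _⟩

theorem IsAmalgam.apply_mul_mem_normalForms (hΓ : IsAmalgam R Θ T φ) (b : Bool) (f : F) {g : Γ}
    (hg : g ∈ normalForms R Θ φ) : φ b f * g ∈ normalForms R Θ φ := by
  by_cases hf : f ∈ (FreeGroup.lift (gen (R b) (Θ b))).range
  · obtain ⟨u, rfl⟩ := hf
    exact hΓ.edge_mul_mem_normalForms b u hg
  rcases hg with ⟨u, rfl⟩ | ⟨b', hg⟩
  · have : ∃ u', edge R Θ φ false u = edge R Θ φ b u' := by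
      cases b
      · exact ⟨u, rfl⟩
      · exact ⟨_, hΓ.edge_eq _ _⟩
    obtain ⟨u', hu'⟩ := this
    rw [hu', edge_apply, ← map_mul]
    refine .inr ⟨b, .single _ _ fun h => hf ?_⟩
    exact (mul_mem_cancel_right (MonoidHom.mem_range.2 ⟨u', rfl⟩)).1 h
  by_cases hb : b' = !b
  · subst hb
    exact .inr ⟨b, .cons _ _ hf _ hg⟩
  have hb' : b' = b := by cases b <;> cases b' <;> simp_all
  subst hb'
  cases hg with
  | single _ f' hf' =>
    rw [← map_mul]
    by_cases h : f * f' ∈ (FreeGroup.lift (gen (R b') (Θ b'))).range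
    · obtain ⟨u, hu⟩ := h
      rw [← hu]
      exact hΓ.edge_mem_normalForms b' u
    · exact .inr ⟨b', .single _ _ h⟩
  | cons _ f' hf' g hg =>
    rw [← mul_assoc, ← map_mul]
    by_cases h : f * f' ∈ (FreeGroup.lift (gen (R b') (Θ b'))).range
    · obtain ⟨u, hu⟩ := h
      rw [← hu]
      exact hΓ.edge_mul_mem_normalForms b' u (.inr ⟨_, hg⟩)
    · exact .inr ⟨b', .cons _ _ h _ hg⟩

/-- The elements that preserve `normalForms` under left multiplication, together with their
inverses, form a subgroup containing both factors. Only existence of the forms is needed, not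
uniqueness. -/
theorem IsAmalgam.mem_normalForms (hΓ : IsAmalgam R Θ T φ) (g : Γ) : g ∈ normalForms R Θ φ := by
  let P : Subgroup Γ :=
    { carrier := {g | (∀ k ∈ normalForms R Θ φ, g * k ∈ normalForms R Θ φ) ∧
        ∀ k ∈ normalForms R Θ φ, g⁻¹ * k ∈ normalForms R Θ φ}
      mul_mem' := by
        rintro a b ⟨ha, ha'⟩ ⟨hb, hb'⟩
        refine ⟨fun k hk => ?_, fun k hk => ?_⟩
        · rw [mul_assoc]; exact ha _ (hb _ hk)
        · rw [mul_inv_rev, mul_assoc]; exact hb' _ (ha' _ hk)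
      one_mem' := by simp
      inv_mem' := by
        rintro a ⟨ha, ha'⟩
        exact ⟨ha', by simpa using ha⟩ }
  have hP : P = ⊤ := hΓ.eq_top P fun b f =>
    ⟨fun k hk => hΓ.apply_mul_mem_normalForms b f hk, fun k hk => by
      rw [← map_inv]; exact hΓ.apply_mul_mem_normalForms b _ hk⟩
  have h1 : (1 : Γ) ∈ normalForms R Θ φ := .inl ⟨1, by simp⟩
  have hg : g ∈ P := hP ▸ Subgroup.mem_top g
  simpa using hg.1 1 h1

/-- Conjugation by an alternating product moves the elements `u₁ u₂⁻¹` along a chain. -/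
theorem Alternating.exists_chain (hΓ : IsAmalgam R Θ T φ) {b : Bool} {g : Γ}
    (hg : Alternating R Θ φ b g) : ∀ h : FreeGroup Label, ∃ (c : List (ℤ × ℤ)) (e : Bool)
      (h' : FreeGroup Label), c ≠ [] ∧ (∀ q ∈ c, q ≠ (0, 0)) ∧ ∀ u₁ u₂ u₁' u₂' : Label,
        Chain (fun b m k => R b m = k) (fun b a a' => T b a = a') b c u₁ u₁' →
        Chain (fun b m k => R b m = k) (fun b a a' => T b a = a') b c u₂ u₂' →
        g⁻¹ * edge R Θ φ b (h * (.of u₁ * (.of u₂)⁻¹) * h⁻¹) * g =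
          edge R Θ φ e (h' * (.of u₁' * (.of u₂')⁻¹) * h'⁻¹) := by
  have step : ∀ (b : Bool) (f : F), f ∉ (FreeGroup.lift (gen (R b) (Θ b))).range →
      ∀ h : FreeGroup Label, ∃ (n l : ℤ) (h' : FreeGroup Label), (n, l) ≠ (0, 0) ∧
        ∀ m m' q q' : ZStar, (m' : ℤ) = m + n → (q' : ℤ) = q + n →
          (R b m' : ℤ) - R b m = R b q' - R b q →
          (φ b f)⁻¹ * edge R Θ φ b (h * (.of (.v 0 m) * (.of (.v 0 q))⁻¹) * h⁻¹) * φ b f =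
          edge R Θ φ (!b) (h' * (.of (T b (.v (-l) m')) * (.of (T b (.v (-l) q')))⁻¹) * h'⁻¹) := by
    intro b f hf h
    -- The step (n, l) of the path is read off from the coset of f⁻¹h; it is not (0, 0) because f is
    -- outside H.
    obtain ⟨u, l, n, hu⟩ :=
      exists_eq_lift_mul (R b) (Θ b) (f⁻¹ * FreeGroup.lift (gen (R b) (Θ b)) h)
    refine ⟨n, l, FreeGroup.map (T b) u, ?_, fun m m' q q' hm hq hR => ?_⟩
    · rintro h0
      obtain ⟨rfl, rfl⟩ := Prod.mk.inj h0
      apply hf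
      refine ⟨h * u⁻¹, ?_⟩
      simp only [zpow_zero, mul_one] at hu
      rw [map_mul, map_inv, ← hu]
      group
    · have key := zpow_mul_zpow_mul_gen_v_mul_inv (Θ b) (l := l) hm hq hR
      have : edge R Θ φ (!b) (FreeGroup.map (T b) u * (.of (T b (.v (-l) m')) *
          (.of (T b (.v (-l) q')))⁻¹) * (FreeGroup.map (T b) u)⁻¹) =
          edge R Θ φ b (u * (.of (.v (-l) m') * (.of (.v (-l) q'))⁻¹) * u⁻¹) := by
        rw [hΓ.edge_eq b]; simp
      rw [this, edge_apply, edge_apply, ← map_inv, ← map_mul, ← map_mul]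
      congr 1
      simp only [map_mul, map_inv, FreeGroup.lift_apply_of]
      set A := FreeGroup.lift (gen (R b) (Θ b)) h
      set B := FreeGroup.lift (gen (R b) (Θ b)) u
      have hf' : f = A * (B * (z ^ l * x ^ n))⁻¹ := by
        rw [← mul_assoc, ← hu]; group
      have key' := congrArg (fun t => B * t * (z ^ l * x ^ n)⁻¹ * B⁻¹) key
      simp only [mul_assoc, mul_inv_rev, hf', inv_inv, inv_mul_cancel_left, mul_inv_cancel_left]
        at key' ⊢
      exact key'
  have hsub : ∀ (b : Bool) (n : ℤ) (m m' q q' : ZStar), (m' : ℤ) = m + n → (q' : ℤ) = q + n →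
      (n = 0 ∨ ∃ k k' : ZStar, R b m = k ∧ R b m' = k' ∧ (k' : ℤ) = k + 1) →
      (n = 0 ∨ ∃ k k' : ZStar, R b q = k ∧ R b q' = k' ∧ (k' : ℤ) = k + 1) →
      (R b m' : ℤ) - R b m = R b q' - R b q := by
    intro b n m m' q q' hm hq h1 h2
    rcases eq_or_ne n 0 with rfl | hn
    · rw [add_zero] at hm hq
      rw [Subtype.ext hm, Subtype.ext hq]
      simp
    · obtain ⟨_, _, rfl, rfl, h1⟩ := h1.resolve_left hn
      obtain ⟨_, _, rfl, rfl, h2⟩ := h2.resolve_left hn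
      omega
  induction hg with
  | single b f hf =>
    intro h
    obtain ⟨n, l, h', h0, hs⟩ := step b f hf h
    refine ⟨[(n, l)], !b, h', by simp, by simpa using h0, ?_⟩
    intro u₁ u₂ u₁' u₂' hc₁ hc₂
    cases hc₁ with | cons hm hk ht hc => ?_
    cases hc₂ with | cons hm' hk' ht' hc' => ?_
    cases hc; cases hc'
    subst ht; subst ht'
    exact hs _ _ _ _ hm hm' (hsub _ _ _ _ _ _ hm hm' hk hk')
  | cons b f hf g hg ih =>
    intro h
    obtain ⟨n, l, h₁, h0, hs⟩ := step b f hf h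
    obtain ⟨c, e, h', -, hc0, hc⟩ := ih h₁
    refine ⟨(n, l) :: c, e, h', by simp, ?_, ?_⟩
    · intro q hq
      rcases List.mem_cons.1 hq with rfl | hq
      · exact h0
      · exact hc0 q hq
    intro u₁ u₂ u₁' u₂' hc₁ hc₂
    cases hc₁ with | cons hm hk ht hd => ?_
    cases hc₂ with | cons hm' hk' ht' hd' => ?_
    subst ht; subst ht'
    rw [← hc _ _ _ _ hd hd', ← hs _ _ _ _ hm hm' (hsub _ _ _ _ _ _ hm hm' hk hk')]
    group

end Amalgam


/-! ### Normal subgroups of a rich amalgam. -/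

section Simple

variable {Γ : Type} [Group Γ] {R Θ : Bool → Equiv.Perm ZStar} {T : Bool → Label ≃ Label}
  {φ : Bool → F →* Γ} {N : Subgroup Γ}

theorem exists_shift_of_isRich (hR : IsRich R T) (hΓ : IsAmalgam R Θ T φ) (b : Bool)
    {f : Label → Label} {s : Finset Label} (hf : Set.InjOn f s) :
    ∃ l l' : ℤ, ∀ a ∈ s, T b (shift l a) = shift l' (f a) := by
  have hnd : (s.toList.map f).Nodup :=
    s.nodup_toList.map_on fun x hx y hy h => hf (by simpa using hx) (by simpa using hy) h
  cases b
  · obtain ⟨l, l', h⟩ := hR.exists_shift (s.toList.map fun a => (a, f a))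
      (by simpa [Function.comp_def] using s.nodup_toList) (by simpa [Function.comp_def] using hnd)
    exact ⟨l, l', fun a ha => h (a, f a) (List.mem_map.2 ⟨a, by simpa using ha, rfl⟩)⟩
  -- On this side T is the inverse bijection, so the pairs are reversed.
  · obtain ⟨l, l', h⟩ := hR.exists_shift (s.toList.map fun a => (f a, a))
      (by simpa [Function.comp_def] using hnd) (by simpa [Function.comp_def] using s.nodup_toList)
    refine ⟨l', l, fun a ha => ?_⟩
    rw [← h (f a, a) (List.mem_map.2 ⟨a, by simpa using ha, rfl⟩)]
    exact hΓ.symm_apply false _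

/-- A relation between generators remains true after replacing the generators by others. -/
theorem edge_map_mem (hR : IsRich R T) (hΓ : IsAmalgam R Θ T φ) [hN : N.Normal] {b : Bool}
    {w : FreeGroup Label} (hw : edge R Θ φ b w ∈ N) {f : Label → Label}
    (hf : Set.InjOn f (letters w)) : edge R Θ φ (!b) (FreeGroup.map f w) ∈ N := by
  obtain ⟨l, l', h⟩ := exists_shift_of_isRich hR hΓ b hf
  -- Shifting the superscripts is conjugation by a power of z, which preserves N on either side.
  have h1 : edge R Θ φ b (FreeGroup.map (shift l) w) ∈ N := by
    rw [edge_map_shift]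
    simpa using hN.conj_mem _ hw (φ b z ^ l)⁻¹
  have h2 : FreeGroup.map (T b) (FreeGroup.map (shift l) w) =
      FreeGroup.map (shift l') (FreeGroup.map f w) := by
    rw [FreeGroup.map.comp, FreeGroup.map.comp]
    exact map_congr_of_letters h
  rw [hΓ.edge_eq, h2, edge_map_shift] at h1
  have := hN.conj_mem _ h1 (φ (!b) z ^ l')
  simpa [mul_assoc] using this

/-- For g outside H, take chains along the path of g starting at u₁ and u₂. Then
g⁻¹(u₁u₂⁻¹)g(u₁u₂⁻¹)⁻¹ lies in both N and H. -/
theorem exists_edge_mem (hR : IsRich R T) (hΓ : IsAmalgam R Θ T φ) [hN : N.Normal] {g : Γ}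
    (hg : g ∈ N) (h1 : g ≠ 1) : ∃ (b : Bool) (w : FreeGroup Label), w ≠ 1 ∧
      edge R Θ φ b w ∈ N := by
  classical
  rcases hΓ.mem_normalForms g with ⟨u, rfl⟩ | ⟨b, hb⟩
  · exact ⟨false, u, by rintro rfl; simp at h1, hg⟩
  obtain ⟨c, e, h', hc, hc0, key⟩ := hb.exists_chain hΓ 1
  obtain ⟨u₁, u₁', -, hu₁, hne, hne'⟩ := hR.exists_chain b c hc hc0 ∅
  obtain ⟨u₂, u₂', hu, hu₂, -, -⟩ := hR.exists_chain b c hc hc0 {u₁}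
  -- The path may end on either side; k rewrites the starting labels on that side. This is why u'
  -- must differ both from u and from its image under T.
  have hside : ∃ k : Label → Label, Function.Injective k ∧ u₁' ≠ k u₁ ∧
      ∀ a, edge R Θ φ b (.of a) = edge R Θ φ e (.of (k a)) := by
    by_cases he : e = b
    · subst he
      exact ⟨id, Function.injective_id, hne, fun a => rfl⟩
    · have he' : e = !b := by cases b <;> cases e <;> simp_all
      subst he'
      exact ⟨T b, (T b).injective, hne', fun a => by rw [hΓ.edge_eq, FreeGroup.map.of]⟩
  obtain ⟨k, hk, hk', hke⟩ := hside
  refine ⟨e, h' * (.of u₁' * (.of u₂')⁻¹) * h'⁻¹ * (.of (k u₁) * (.of (k u₂))⁻¹)⁻¹, ?_, ?_⟩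
  · intro h
    -- The exponent sum of the letter k u₁ in the word is -1 or -2, so the word is nontrivial.
    let f : Label → Multiplicative ℤ := fun a => if a = k u₁ then .ofAdd 1 else 1
    have hk2 : k u₂ ≠ k u₁ := fun h => hu (by simp [hk h])
    have h2 := congrArg (FreeGroup.lift f) h
    simp only [map_mul, map_inv, FreeGroup.lift_apply_of, map_one] at h2
    rw [mul_right_comm _ _ (FreeGroup.lift f h')⁻¹] at h2
    simp only [f, hk', hk2, if_true, if_false, mul_inv_cancel, one_mul, inv_one, mul_one] at h2
    have h3 := congrArg Multiplicative.toAdd h2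
    split_ifs at h3 <;> simp at h3
  · rw [map_mul, ← key _ _ _ _ hu₁ hu₂]
    have : edge R Θ φ e (.of (k u₁) * (.of (k u₂))⁻¹)⁻¹ =
        (edge R Θ φ b (.of u₁ * (.of u₂)⁻¹))⁻¹ := by
      simp [hke]
    rw [this, one_mul, inv_one, mul_one]
    have h3 := hN.conj_mem _ hg (edge R Θ φ b (.of u₁ * (.of u₂)⁻¹))
    have h4 := N.mul_mem (N.inv_mem hg) h3
    simpa [mul_assoc] using h4

/-- The points of the set on which the free group acts by its right regular representation can be
used as exponents of `x`. -/
theorem exists_walk (ρ θ : Equiv.Perm ZStar) (e : FreeGroup Label ≃ ZStar) (w : FreeGroup Label) :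
    ∀ g : FreeGroup Label, ∃ (A : Finset Label) (P : Finset ZStar), ∀ m : Label → ZStar,
      (∀ a ∈ A, ∀ i ∈ P, ∃ m' : ZStar, (m' : ℤ) = m a + i ∧
        (ρ m' : ℤ) = ρ (m a) + ρ (e (e.symm i * .of a))) →
      x ^ (e g : ℤ) * FreeGroup.lift (gen ρ θ) (FreeGroup.map (fun a => Label.v 0 (m a)) w) *
        (x ^ (e (g * w) : ℤ))⁻¹ ∈ (FreeGroup.lift (gen ρ θ)).range := by
  classical
  have step : ∀ (m i j : ZStar), (∃ m' : ZStar, (m' : ℤ) = m + i ∧ (ρ m' : ℤ) = ρ m + ρ j) →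
      x ^ (i : ℤ) * gen ρ θ (.v 0 m) * (x ^ (j : ℤ))⁻¹ ∈ (FreeGroup.lift (gen ρ θ)).range := by
    rintro m i j ⟨m', h1, h2⟩
    refine ⟨.of (.v 0 m') * (.of (.v 0 j))⁻¹, ?_⟩
    rw [x_zpow_mul_gen_v θ h1 h2]
    simp
  induction w using FreeGroup.induction_on with
  | C1 => exact fun g => ⟨∅, ∅, fun m _ => ⟨1, by simp⟩⟩
  | of a =>
    intro g
    refine ⟨{a}, {e g}, fun m hm => ?_⟩
    have := hm a (by simp) (e g) (by simp)
    rw [e.symm_apply_apply] at this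
    simpa using step _ _ _ this
  | inv_of a _ =>
    intro g
    -- An inverse letter is the step of a that starts at g a⁻¹, traversed backwards.
    refine ⟨{a}, {e (g * (.of a)⁻¹)}, fun m hm => ?_⟩
    have := hm a (by simp) (e (g * (.of a)⁻¹)) (by simp)
    rw [e.symm_apply_apply, inv_mul_cancel_right] at this
    have := Subgroup.inv_mem _ (step _ _ _ this)
    simpa [mul_assoc] using this
  | mul a b ha hb =>
    intro g
    obtain ⟨A₁, P₁, h₁⟩ := ha g
    obtain ⟨A₂, P₂, h₂⟩ := hb (g * a)
    refine ⟨A₁ ∪ A₂, P₁ ∪ P₂, fun m hm => ?_⟩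
    have := Subgroup.mul_mem _
      (h₁ m fun a ha i hi => hm a (Finset.mem_union_left _ ha) i (Finset.mem_union_left _ hi))
      (h₂ m fun a ha i hi => hm a (Finset.mem_union_right _ ha) i (Finset.mem_union_right _ hi))
    simpa [mul_assoc] using this

/-- Index the nonzero powers of x by the free group on the labels, and replace each letter a of w by
some v_m acting on the relevant cosets as right multiplication by a. The new word moves the coset of
x^{e(1)} to that of x^{e(w)}, a different one. -/
theorem exists_mem_notMem_range (hR : IsRich R T) (hΓ : IsAmalgam R Θ T φ) [hN : N.Normal]
    {b : Bool} {w : FreeGroup Label} (hw : w ≠ 1) (hwN : edge R Θ φ b w ∈ N) :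
    ∃ (b : Bool) (f : F), f ∉ (FreeGroup.lift (gen (R b) (Θ b))).range ∧ φ b f ∈ N := by
  classical
  obtain ⟨e⟩ : Nonempty (FreeGroup Label ≃ ZStar) := nonempty_equiv_of_countable
  obtain ⟨A, P, hAP⟩ := exists_walk (R !b) (Θ !b) e w 1
  have hchoice := exists_injOn_choice (A ∪ letters w)
    (P := fun (a : Label) (m : ZStar) => ∀ i ∈ P, ∃ m' : ZStar, (m' : ℤ) = m + i ∧
        (R (!b) m' : ℤ) = R (!b) m + R (!b) (e (e.symm i * .of a))) ?_
  · obtain ⟨m, hm, hmP⟩ := hchoice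
    refine ⟨!b, x ^ (e 1 : ℤ) * FreeGroup.lift (gen (R !b) (Θ !b))
      (FreeGroup.map (fun a => Label.v 0 (m a)) w) * (x ^ (e 1 : ℤ))⁻¹, fun h => ?_, ?_⟩
    · have h2 := hAP m fun a ha => hmP a (Finset.mem_union_left _ ha)
      obtain ⟨u, hu⟩ := Subgroup.mul_mem _ (Subgroup.inv_mem _ h2) h
      have hu' : FreeGroup.lift (gen (R !b) (Θ !b)) u = x ^ ((e w : ℤ) - e 1) := by
        rw [hu, zpow_sub, one_mul]; group
      have := eq_zero_of_lift_gen_eq hu'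
      exact hw (e.injective (Subtype.ext (sub_eq_zero.1 this)))
    · have hinj : Set.InjOn (fun a => Label.v 0 (m a)) (letters w) := by
        intro a ha a' ha' h
        exact hm (by simpa using Or.inr ha) (by simpa using Or.inr ha') (by simpa using h)
      have := edge_map_mem hR hΓ hwN hinj
      rw [map_mul, map_mul, map_inv]
      exact hN.conj_mem _ this _
  · intro a _ B
    obtain ⟨m, hm, h⟩ := hR.exists_line (!b)
      (P.toList.map fun i => (i, R (!b) (e (e.symm i * .of a))))
      (by simpa [Function.comp_def] using P.nodup_toList) (by
        rw [List.map_map]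
        refine P.nodup_toList.map ?_
        intro i j hij
        simpa using hij) B
    exact ⟨m, hm, fun i hi => h _ (List.mem_map.2 ⟨i, by simpa using hi, rfl⟩)⟩

/-- The subscript of a label. -/
def subscript : Label → ZStar
  | .v _ j => j
  | .w _ j => j

/-- With f = u z^l x^n, choose d = v_m fixing the coset of z^l x^n. The commutator d⁻¹fdf⁻¹ is then
d⁻¹utu⁻¹, where d occurs in neither u nor t. Comparing it with its copy for a fresh d' leaves d'⁻¹d.
-/
theorem exists_mul_inv_mem (hR : IsRich R T) (hΓ : IsAmalgam R Θ T φ) [hN : N.Normal]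
    {b : Bool} {f : F} (hf : f ∉ (FreeGroup.lift (gen (R b) (Θ b))).range) (hfN : φ b f ∈ N) :
    ∃ (b : Bool) (d d' : Label), d ≠ d' ∧ edge R Θ φ b ((.of d)⁻¹ * .of d') ∈ N := by
  classical
  obtain ⟨u, l, n, rfl⟩ := exists_eq_lift_mul (R b) (Θ b) f
  have hstep : ∃ (m : ZStar) (t : FreeGroup Label) (B : Finset Label),
      Label.v 0 m ∉ letters u ∧ Label.v 0 m ∉ B ∧
      (∀ k : Label → Label, (∀ a ∈ B, k a = a) → FreeGroup.map k t = t) ∧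
      z ^ l * x ^ n * gen (R b) (Θ b) (.v 0 m) =
        FreeGroup.lift (gen (R b) (Θ b)) t * (z ^ l * x ^ n) := by
    rcases eq_or_ne n 0 with rfl | hn
    · have hl : l ≠ 0 := by
        rintro rfl
        exact hf ⟨u, by simp⟩
      obtain ⟨m, hm⟩ := Infinite.exists_notMem_finset ((letters u).image subscript)
      refine ⟨m, .of (.v (-l) m), {.v (-l) m}, fun h => hm (Finset.mem_image.2 ⟨_, h, rfl⟩),
        by simpa using hl, fun k hk => by simp [hk], ?_⟩
      simp only [FreeGroup.lift_apply_of, gen]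
      group
    -- The condition ρ(m+n) = ρ(m) + ρ(n) says that v_m fixes the coset of x^n.
    · obtain ⟨m, hm, h⟩ := hR.exists_line b [(⟨n, hn⟩, R b ⟨n, hn⟩)] (by simp) (by simp)
        ((letters u).image subscript ∪ {⟨n, hn⟩})
      obtain ⟨m', hm', hRm⟩ := h _ (List.mem_singleton_self _)
      simp only [Finset.mem_union, not_or, Finset.mem_singleton] at hm
      refine ⟨m, .of (.v (-l) m') * (.of (.v (-l) ⟨n, hn⟩))⁻¹, {.v (-l) m', .v (-l) ⟨n, hn⟩},
        fun h => hm.1 (Finset.mem_image.2 ⟨_, h, rfl⟩), ?_, fun k hk => by simp [hk], ?_⟩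
      · simp only [Finset.mem_insert, Finset.mem_singleton, Label.v.injEq, not_or, not_and]
        refine ⟨fun _ h => hn ?_, fun _ => hm.2⟩
        rw [← h] at hm'
        simpa using hm'
      · rw [zpow_mul_zpow_mul_gen_v (Θ b) l (i := ⟨n, hn⟩) hm' hRm]
        simp
  obtain ⟨m, t, B, hmu, hmB, hB, ht⟩ := hstep
  obtain ⟨d', hd'⟩ := Infinite.exists_notMem_finset (letters u ∪ B ∪ {.v 0 m})
  simp only [Finset.mem_union, not_or, Finset.mem_singleton] at hd'
  set d := Label.v 0 m with hd
  have hW : edge R Θ φ b ((.of d)⁻¹ * (u * t * u⁻¹)) ∈ N := by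
    set f := FreeGroup.lift (gen (R b) (Θ b)) u * z ^ l * x ^ n with hfdef
    have h1 : edge R Θ φ b ((.of d)⁻¹ * (u * t * u⁻¹)) =
        (φ b (gen (R b) (Θ b) d))⁻¹ * φ b f * φ b (gen (R b) (Θ b) d) * (φ b f)⁻¹ := by
      rw [edge_apply, ← map_inv, ← map_inv, ← map_mul, ← map_mul, ← map_mul]
      congr 1
      have h2 : f * gen (R b) (Θ b) d = FreeGroup.lift (gen (R b) (Θ b)) (u * t * u⁻¹) * f := by
        rw [hfdef, mul_assoc _ (z ^ l), mul_assoc, ht]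
        simp [mul_assoc]
      rw [mul_assoc _ f, h2]
      simp only [map_mul, map_inv, FreeGroup.lift_apply_of, mul_assoc, mul_inv_cancel, mul_one]
    rw [h1]
    have h3 := hN.conj_mem _ hfN (φ b (gen (R b) (Θ b) d))⁻¹
    rw [inv_inv] at h3
    exact N.mul_mem h3 (N.inv_mem hfN)
  -- The trivial renaming carries the original word to the other side, where the renamed one lives.
  have h1 := edge_map_mem hR hΓ hW (f := id) Function.injective_id.injOn
  have h2 := edge_map_mem hR hΓ hW (f := Equiv.swap d d') (Equiv.injective _).injOn
  have hfix : ∀ a, a ≠ d → a ≠ d' → Equiv.swap d d' a = a :=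
    fun a => Equiv.swap_apply_of_ne_of_ne
  have hu : FreeGroup.map (Equiv.swap d d') u = u := by
    conv_rhs => rw [← FreeGroup.map.id u]
    refine map_congr_of_letters fun a ha => hfix a ?_ ?_
    · rintro rfl; exact hmu ha
    · rintro rfl; exact hd'.1.1 ha
  have ht' : FreeGroup.map (Equiv.swap d d') t = t := by
    refine hB _ fun a ha => hfix a ?_ ?_
    · rintro rfl; exact hmB ha
    · rintro rfl; exact hd'.1.2 ha
  rw [FreeGroup.map.id] at h1
  simp only [map_mul, map_inv, hu, ht', FreeGroup.map.of, Equiv.swap_apply_left] at h1 h2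
  refine ⟨!b, d', d, hd'.2, ?_⟩
  have := N.mul_mem h2 (N.inv_mem h1)
  simpa [mul_assoc] using this

theorem forall_mul_inv_mem (hR : IsRich R T) (hΓ : IsAmalgam R Θ T φ) [hN : N.Normal]
    {b : Bool} {d d' : Label} (hd : d ≠ d') (h : edge R Θ φ b ((.of d)⁻¹ * .of d') ∈ N)
    (b' : Bool) (a a' : Label) : edge R Θ φ b' ((.of a)⁻¹ * .of a') ∈ N := by
  classical
  have key : ∀ (b : Bool) (d d' : Label), d ≠ d' → edge R Θ φ b ((.of d)⁻¹ * .of d') ∈ N →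
      ∀ a a', edge R Θ φ (!b) ((.of a)⁻¹ * .of a') ∈ N := by
    intro b d d' hd h a a'
    rcases eq_or_ne a a' with rfl | ha
    · simp
    have h1 := edge_map_mem hR hΓ h
      -- This permutation sends d to a and d' to a'.
      (f := (Equiv.swap d a).trans (Equiv.swap (Equiv.swap d a d') a')) (Equiv.injective _).injOn
    have h2 : a ≠ Equiv.swap d a d' := by
      intro h
      have := (Equiv.swap_apply_left d a).trans h
      exact hd ((Equiv.swap d a).injective this)
    simpa [Equiv.swap_apply_of_ne_of_ne h2 ha] using h1
  have h1 := key b d d' hd h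
  by_cases hb : b' = !b
  · exact hb ▸ h1 a a'
  · have hb' : (!!b) = b' := by cases b <;> cases b' <;> simp_all
    exact hb' ▸ key (!b) d d' hd (h1 d d') a a'

theorem eq_top_of_forall_mem (hR : IsRich R T) (hΓ : IsAmalgam R Θ T φ) [hN : N.Normal]
    (h : ∀ (b : Bool) (a a' : Label), edge R Θ φ b ((.of a)⁻¹ * .of a') ∈ N) : N = ⊤ := by
  refine hΓ.eq_top N fun b => ?_
  let q : F →* Γ ⧸ N := (QuotientGroup.mk' N).comp (φ b)
  have hq : ∀ a a', q (gen (R b) (Θ b) a) = q (gen (R b) (Θ b) a') := by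
    intro a a'
    refine QuotientGroup.eq.2 ?_
    simpa [edge] using h b a a'
  -- Modulo N, increments (1, 1) give v_m = v_{m+1}, hence x = y; increments (2, 3) then give y = 1
  -- because 2 ≠ 3 differ by one. Comparing w_m with v_m gives z = 1.
  obtain ⟨m, -, hm⟩ := hR.exists_line b
    [(⟨1, by simp⟩, ⟨1, by simp⟩), (⟨2, by simp⟩, ⟨3, by simp⟩)] (by simp) (by simp) ∅
  obtain ⟨m₁, hm₁, hR₁⟩ := hm (⟨1, by simp⟩, ⟨1, by simp⟩) (by simp)
  obtain ⟨m₂, hm₂, hR₂⟩ := hm (⟨2, by simp⟩, ⟨3, by simp⟩) (by simp)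
  change (m₁ : ℤ) = m + 1 at hm₁
  change (m₂ : ℤ) = m + 2 at hm₂
  change (R b m₁ : ℤ) = R b m + 1 at hR₁
  change (R b m₂ : ℤ) = R b m + 3 at hR₂
  have hxy : q x = q y := by
    have := hq (.v 0 m) (.v 0 m₁)
    simp only [gen, hm₁, hR₁, map_mul, map_zpow, neg_add, zpow_add, zpow_zero, inv_one,
      one_mul, mul_one, mul_assoc] at this
    rw [(Commute.refl (q y)).zpow_zpow (-(R b m : ℤ)) (-1), mul_left_cancel_iff,
      ← mul_assoc, right_eq_mul] at this
    simpa [mul_inv_eq_one] using this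
  have hy : q y = 1 := by
    have := hq (.v 0 m) (.v 0 m₂)
    simp only [gen, hm₂, hR₂, map_mul, map_zpow, hxy, ← zpow_add, zpow_zero, inv_one,
      one_mul, mul_one] at this
    have h2 := (mul_inv_eq_one.2 this)
    rw [← zpow_neg, ← zpow_add] at h2
    have h3 : (m : ℤ) + -(R b m : ℤ) + -((m : ℤ) + 2 + -((R b m : ℤ) + 3)) = 1 := by ring
    rwa [h3, zpow_one] at h2
  have hx : q x = 1 := hxy.trans hy
  have hz : q z = 1 := by
    have := hq (.w 0 m) (.v 0 m)
    simpa [gen, hx, hy] using this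
  have hq1 : q = 1 := by
    ext i
    fin_cases i
    · exact hx
    · exact hy
    · exact hz
  intro f
  have := DFunLike.congr_fun hq1 f
  exact (QuotientGroup.eq_one_iff _).1 this

theorem isSimpleGroup_of_isRich (hR : IsRich R T) (hΓ : IsAmalgam R Θ T φ) : IsSimpleGroup Γ := by
  have : Nontrivial Γ := by
    refine ⟨φ false x, 1, fun h => ?_⟩
    rw [← map_one (φ false)] at h
    exact FreeGroup.of_ne_one (0 : Fin 3) (hΓ.injective _ h)
  refine ⟨fun N hN => ?_⟩
  rw [or_iff_not_imp_left]
  intro hbot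
  obtain ⟨⟨g, hg⟩, hg1⟩ := Subgroup.ne_bot_iff_exists_ne_one.1 hbot
  obtain ⟨b, w, hw, hwN⟩ := exists_edge_mem hR hΓ hg (fun h => hg1 (Subtype.ext h))
  obtain ⟨b, f, hf, hfN⟩ := exists_mem_notMem_range hR hΓ hw hwN
  obtain ⟨b, d, d', hd, hdN⟩ := exists_mul_inv_mem hR hΓ hf hfN
  exact eq_top_of_forall_mem hR hΓ (forall_mul_inv_mem hR hΓ hd hdN)

end Simple


/-! ### Finite partial injections and their unions. -/

/-- A finite partial injection, with finite sets of elements that are kept out of its domain and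
of its image. -/
structure FinInj (α β : Type) where
  graph : List (α × β)
  resL : List α
  resR : List β
  inj : ∀ p ∈ graph, ∀ q ∈ graph, p.1 = q.1 ↔ p.2 = q.2
  notMem_resL : ∀ p ∈ graph, p.1 ∉ resL
  notMem_resR : ∀ p ∈ graph, p.2 ∉ resR

namespace FinInj

variable {α β : Type}

instance : Preorder (FinInj α β) where
  le p q := p.graph ⊆ q.graph ∧ p.resL ⊆ q.resL ∧ p.resR ⊆ q.resR
  le_refl p := ⟨List.Subset.refl _, List.Subset.refl _, List.Subset.refl _⟩
  le_trans p q r h h' := ⟨List.Subset.trans h.1 h'.1, List.Subset.trans h.2.1 h'.2.1,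
    List.Subset.trans h.2.2 h'.2.2⟩

/-- The partial injection with empty graph and nothing reserved. -/
def empty : FinInj α β := ⟨[], [], [], by simp, by simp, by simp⟩

/-- The elements in the domain or kept out of it. -/
def usedL (p : FinInj α β) : Set α := {a | a ∈ p.resL ∨ a ∈ p.graph.map Prod.fst}

/-- The elements in the image or kept out of it. -/
def usedR (p : FinInj α β) : Set β := {b | b ∈ p.resR ∨ b ∈ p.graph.map Prod.snd}

theorem finite_usedL (p : FinInj α β) : p.usedL.Finite :=
  (List.finite_toSet p.resL).union (List.finite_toSet (p.graph.map Prod.fst))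

theorem finite_usedR (p : FinInj α β) : p.usedR.Finite :=
  (List.finite_toSet p.resR).union (List.finite_toSet (p.graph.map Prod.snd))

theorem exists_insert (p : FinInj α β) {a : α} {b : β} (ha : a ∉ p.usedL) (hb : b ∉ p.usedR) :
    ∃ p' ≥ p, (a, b) ∈ p'.graph ∧ p'.usedL = insert a p.usedL ∧
      p'.usedR = insert b p.usedR := by
  have ha' : ∀ q ∈ p.graph, q.1 ≠ a := fun q hq h =>
    ha (.inr (List.mem_map.2 ⟨q, hq, h⟩))
  have hb' : ∀ q ∈ p.graph, q.2 ≠ b := fun q hq h =>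
    hb (.inr (List.mem_map.2 ⟨q, hq, h⟩))
  refine ⟨⟨(a, b) :: p.graph, p.resL, p.resR, ?_, ?_, ?_⟩, ?_, by simp, ?_, ?_⟩
  · intro q hq q' hq'
    rcases List.mem_cons.1 hq with rfl | hq <;> rcases List.mem_cons.1 hq' with rfl | hq'
    · simp
    · exact iff_of_false (ha' _ hq').symm (hb' _ hq').symm
    · exact iff_of_false (ha' _ hq) (hb' _ hq)
    · exact p.inj _ hq _ hq'
  · intro q hq
    rcases List.mem_cons.1 hq with rfl | hq
    · exact fun h => ha (.inl h)
    · exact p.notMem_resL _ hq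
  · intro q hq
    rcases List.mem_cons.1 hq with rfl | hq
    · exact fun h => hb (.inl h)
    · exact p.notMem_resR _ hq
  · exact ⟨List.subset_cons_self _ _, List.Subset.refl _, List.Subset.refl _⟩
  · ext c
    simp only [usedL, List.map_cons, List.mem_cons, Set.mem_ofPred_eq, Set.mem_insert_iff]
    tauto
  · ext c
    simp only [usedR, List.map_cons, List.mem_cons, Set.mem_ofPred_eq, Set.mem_insert_iff]
    tauto

theorem exists_insert_list (ps : List (α × β)) : ∀ p : FinInj α β, (ps.map Prod.fst).Nodup →
    (ps.map Prod.snd).Nodup → (∀ q ∈ ps, q.1 ∉ p.usedL ∧ q.2 ∉ p.usedR) →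
    ∃ p' ≥ p, ps ⊆ p'.graph := by
  induction ps with
  | nil => exact fun p _ _ _ => ⟨p, le_rfl, by simp⟩
  | cons q ps ih =>
    intro p h1 h2 h
    obtain ⟨a, b⟩ := q
    obtain ⟨p₁, hp₁, hq, hL, hR⟩ := p.exists_insert (h (a, b) (by simp)).1 (h (a, b) (by simp)).2
    rw [List.map_cons, List.nodup_cons] at h1 h2
    obtain ⟨p', hp', hps⟩ := ih p₁ h1.2 h2.2 fun q hq => by
      rw [hL, hR, Set.mem_insert_iff, Set.mem_insert_iff, not_or, not_or]
      have := h q (by simp [hq])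
      exact ⟨⟨fun e => h1.1 (List.mem_map.2 ⟨q, hq, e⟩), this.1⟩,
        fun e => h2.1 (List.mem_map.2 ⟨q, hq, e⟩), this.2⟩
    exact ⟨p', hp₁.trans hp', List.cons_subset.2 ⟨hp'.1 hq, hps⟩⟩

/-- Reserved elements stay outside the domain and the image in all later extensions, so reserving
infinitely often makes both complements infinite. -/
theorem exists_reserve [Infinite α] [Infinite β] (p : FinInj α β) (A : Finset α) (B : Finset β) :
    ∃ p' ≥ p, (∃ a ∉ A, a ∈ p'.resL) ∧ ∃ b ∉ B, b ∈ p'.resR := by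
  obtain ⟨a, ha⟩ := (p.finite_usedL.union A.finite_toSet).exists_notMem
  obtain ⟨b, hb⟩ := (p.finite_usedR.union B.finite_toSet).exists_notMem
  simp only [Set.mem_union, not_or, Finset.mem_coe] at ha hb
  refine ⟨⟨p.graph, a :: p.resL, b :: p.resR, p.inj, ?_, ?_⟩, ?_, ⟨a, ha.2, by simp⟩,
    b, hb.2, by simp⟩
  · intro q hq h
    rcases List.mem_cons.1 h with h | h
    · exact ha.1 (.inr (List.mem_map.2 ⟨q, hq, h⟩))
    · exact p.notMem_resL _ hq h
  · intro q hq h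
    rcases List.mem_cons.1 h with h | h
    · exact hb.1 (.inr (List.mem_map.2 ⟨q, hq, h⟩))
    · exact p.notMem_resR _ hq h
  · exact ⟨List.Subset.refl _, List.subset_cons_self _ _, List.subset_cons_self _ _⟩

/-- The union of an increasing sequence of finite partial injections. -/
theorem exists_pequiv {s : ℕ → FinInj α β} (hs : Monotone s) :
    ∃ f : α ≃. β, ∀ a b, b ∈ f a ↔ ∃ n, (a, b) ∈ (s n).graph := by
  classical
  have hinj : ∀ a b a' b', (∃ n, (a, b) ∈ (s n).graph) → (∃ n, (a', b') ∈ (s n).graph) →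
      (a = a' ↔ b = b') := by
    rintro a b a' b' ⟨n, hn⟩ ⟨n', hn'⟩
    exact (s (max n n')).inj _ ((hs (le_max_left n n')).1 hn) _ ((hs (le_max_right n n')).1 hn')
  let f : α → Option β := fun a =>
    if h : ∃ b n, (a, b) ∈ (s n).graph then some h.choose else none
  let g : β → Option α := fun b =>
    if h : ∃ a n, (a, b) ∈ (s n).graph then some h.choose else none
  have hf : ∀ a b, b ∈ f a ↔ ∃ n, (a, b) ∈ (s n).graph := by
    intro a b
    by_cases h : ∃ b n, (a, b) ∈ (s n).graph
    · have : f a = some h.choose := dif_pos h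
      rw [this, Option.mem_some_iff]
      exact ⟨fun e => e ▸ h.choose_spec, fun e => (hinj _ _ _ _ h.choose_spec e).1 rfl⟩
    · have : f a = none := dif_neg h
      rw [this]
      exact iff_of_false (by simp) fun e => h ⟨b, e⟩
  have hg : ∀ a b, a ∈ g b ↔ ∃ n, (a, b) ∈ (s n).graph := by
    intro a b
    by_cases h : ∃ a n, (a, b) ∈ (s n).graph
    · have : g b = some h.choose := dif_pos h
      rw [this, Option.mem_some_iff]
      exact ⟨fun e => e ▸ h.choose_spec, fun e => (hinj _ _ _ _ h.choose_spec e).2 rfl⟩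
    · have : g b = none := dif_neg h
      rw [this]
      exact iff_of_false (by simp) fun e => h ⟨a, e⟩
  exact ⟨⟨f, g, fun a b => (hg a b).trans (hf a b).symm⟩, hf⟩

theorem coInfinite [Countable α] [Countable β] {s : ℕ → FinInj α β} (hs : Monotone s)
    {f : α ≃. β} (hf : ∀ a b, b ∈ f a ↔ ∃ n, (a, b) ∈ (s n).graph)
    (hL : ∀ A : Finset α, ∃ n, ∃ a ∉ A, a ∈ (s n).resL)
    (hR : ∀ B : Finset β, ∃ n, ∃ b ∉ B, b ∈ (s n).resR) : CoInfinite f := by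
  refine ⟨⟨fun hfin => ?_, Set.to_countable _⟩, fun hfin => ?_, Set.to_countable _⟩
  · obtain ⟨n, a, ha, han⟩ := hL hfin.toFinset
    refine ha (hfin.mem_toFinset.2 (Option.eq_none_iff_forall_not_mem.2 fun b hb => ?_))
    obtain ⟨n', hn'⟩ := (hf a b).1 hb
    exact (s (max n n')).notMem_resL _ ((hs (le_max_right n n')).1 hn')
      ((hs (le_max_left n n')).2.1 han)
  · obtain ⟨n, b, hb, hbn⟩ := hR hfin.toFinset
    refine hb (hfin.mem_toFinset.2 (Option.eq_none_iff_forall_not_mem.2 fun a ha => ?_))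
    obtain ⟨n', hn'⟩ := (hf a b).1 (f.mem_iff_mem.1 ha)
    exact (s (max n n')).notMem_resR _ ((hs (le_max_right n n')).1 hn')
      ((hs (le_max_left n n')).2.2 hbn)

end FinInj

/-! ### Extending finite conditions. -/

/-- Finite pieces of the three partial bijections. -/
abbrev Cond : Type := (Bool → FinInj ZStar ZStar) × FinInj Label Label

namespace Cond

/-- The labels `a` on the side `b` and `a'` on the other side correspond to each other. -/
def link (i : FinInj Label Label) : Bool → Label → Label → Prop
  | false, a, a' => (a, a') ∈ i.graph
  | true, a, a' => (a', a) ∈ i.graph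

/-- The labels used on the side `b`. -/
def used (i : FinInj Label Label) : Bool → Set Label
  | false => i.usedL
  | true => i.usedR

theorem finite_used (i : FinInj Label Label) : ∀ b, (used i b).Finite
  | false => i.finite_usedL
  | true => i.finite_usedR

theorem link_mono {i i' : FinInj Label Label} (h : i ≤ i') :
    ∀ b a a', link i b a a' → link i' b a a'
  | false, _, _, ha => h.1 ha
  | true, _, _, ha => h.1 ha

theorem exists_link (i : FinInj Label Label) (b : Bool) {a a' : Label} (ha : a ∉ used i b)
    (ha' : a' ∉ used i (!b)) : ∃ i' ≥ i, link i' b a a' ∧ used i' b = insert a (used i b) ∧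
      used i' (!b) = insert a' (used i (!b)) := by
  cases b
  · exact i.exists_insert ha ha'
  · obtain ⟨i', h1, h2, h3, h4⟩ := i.exists_insert ha' ha
    exact ⟨i', h1, h2, h4, h3⟩

/-- The chains in which all the values needed belong to the finite pieces. -/
def chain (p : Cond) : Bool → List (ℤ × ℤ) → Label → Label → Prop :=
  Chain (fun b m k => (m, k) ∈ (p.1 b).graph) (link p.2)

end Cond

theorem exists_translate (ns : List ℤ) {U : Set ZStar} (hU : U.Finite) :
    ∃ m : ℤ, ∀ n ∈ ns, ∃ m' : ZStar, (m' : ℤ) = m + n ∧ m' ∉ U := by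
  have hfin : (⋃ n ∈ {n | n ∈ ns}, (fun k : ℤ => k - n) '' (insert 0 (Subtype.val '' U))).Finite :=
    (List.finite_toSet ns).biUnion fun n _ => ((hU.image _).insert 0).image _
  obtain ⟨m, hm⟩ := hfin.exists_notMem
  simp only [Set.mem_iUnion, not_exists] at hm
  refine ⟨m, fun n hn => ?_⟩
  have h1 := hm n hn
  refine ⟨⟨m + n, fun h => h1 ⟨m + n, .inl h, by simp⟩⟩, rfl, fun h => h1 ?_⟩
  exact ⟨m + n, .inr ⟨_, h, rfl⟩, by simp⟩

theorem exists_translate_lists (κ : List (ZStar × ZStar)) (h1 : (κ.map Prod.fst).Nodup)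
    (h2 : (κ.map Prod.snd).Nodup) (p : FinInj ZStar ZStar) (A : Finset ZStar) :
    ∃ p' ≥ p, ∃ m ∉ A, ∃ k, (m, k) ∈ p'.graph ∧ ∀ q ∈ κ, ∃ m' k' : ZStar,
      (m' : ℤ) = m + q.1 ∧ (k' : ℤ) = k + q.2 ∧ (m', k') ∈ p'.graph := by
  -- The entry 0 makes the base point itself nonzero and fresh.
  obtain ⟨m, hm⟩ := exists_translate (0 :: κ.map fun q => (q.1 : ℤ))
    (p.finite_usedL.union A.finite_toSet)
  obtain ⟨k, hk⟩ := exists_translate (0 :: κ.map fun q => (q.2 : ℤ)) p.finite_usedR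
  choose! f hf hfU using hm
  choose! g hg hgU using hk
  have hfκ : ∀ q ∈ κ, (q.1 : ℤ) ∈ (0 :: κ.map fun q => (q.1 : ℤ)) := fun q hq =>
    List.mem_cons_of_mem _ (List.mem_map.2 ⟨q, hq, rfl⟩)
  have hgκ : ∀ q ∈ κ, (q.2 : ℤ) ∈ (0 :: κ.map fun q => (q.2 : ℤ)) := fun q hq =>
    List.mem_cons_of_mem _ (List.mem_map.2 ⟨q, hq, rfl⟩)
  have hf0 := hf 0 (by simp)
  have hg0 := hg 0 (by simp)
  have key := FinInj.exists_insert_list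
    ((f 0, g 0) :: κ.map fun q => (f q.1, g q.2)) p ?_ ?_ ?_
  · obtain ⟨p', hp', hsub⟩ := key
    refine ⟨p', hp', f 0, fun h => hfU 0 (by simp) (.inr h), g 0, hsub (by simp),
      fun q hq => ⟨f q.1, g q.2, ?_, ?_, hsub ?_⟩⟩
    · rw [hf _ (hfκ q hq), hf0, add_zero]
    · rw [hg _ (hgκ q hq), hg0, add_zero]
    · exact List.mem_cons_of_mem _ (List.mem_map.2 ⟨q, hq, rfl⟩)
  · rw [List.map_cons, List.nodup_cons, List.map_map]
    constructor
    · intro h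
      obtain ⟨q, hq, h⟩ := List.mem_map.1 h
      have h' : f q.1 = f 0 := h
      have := hf _ (hfκ q hq)
      rw [h', hf0] at this
      exact q.1.2 (by omega)
    · have : κ.map (Prod.fst ∘ fun q => (f q.1, g q.2)) =
          (κ.map Prod.fst).map fun n : ZStar => f n := by
        rw [List.map_map]; rfl
      rw [this]
      refine h1.map_on fun n hn n' hn' h => Subtype.ext ?_
      obtain ⟨q, hq, rfl⟩ := List.mem_map.1 hn
      obtain ⟨q', hq', rfl⟩ := List.mem_map.1 hn'
      have e := hf _ (hfκ q hq)
      rw [h, hf _ (hfκ q' hq')] at e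
      omega
  · rw [List.map_cons, List.nodup_cons, List.map_map]
    constructor
    · intro h
      obtain ⟨q, hq, h⟩ := List.mem_map.1 h
      have h' : g q.2 = g 0 := h
      have := hg _ (hgκ q hq)
      rw [h', hg0] at this
      exact q.2.2 (by omega)
    · have : κ.map (Prod.snd ∘ fun q => (f q.1, g q.2)) =
          (κ.map Prod.snd).map fun n : ZStar => g n := by
        rw [List.map_map]; rfl
      rw [this]
      refine h2.map_on fun n hn n' hn' h => Subtype.ext ?_
      obtain ⟨q, hq, rfl⟩ := List.mem_map.1 hn
      obtain ⟨q', hq', rfl⟩ := List.mem_map.1 hn'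
      have e := hg _ (hgκ q hq)
      rw [h, hg _ (hgκ q' hq')] at e
      omega
  · intro q hq
    rcases List.mem_cons.1 hq with rfl | hq
    · exact ⟨fun h => hfU 0 (by simp) (.inl h), hgU 0 (by simp)⟩
    · obtain ⟨q', hq', rfl⟩ := List.mem_map.1 hq
      exact ⟨fun h => hfU _ (hfκ q' hq') (.inl h), hgU _ (hgκ q' hq')⟩

theorem exists_shift_lists (ps : List (Label × Label)) (h1 : (ps.map Prod.fst).Nodup)
    (h2 : (ps.map Prod.snd).Nodup) (i : FinInj Label Label) :
    ∃ i' ≥ i, ∃ l l' : ℤ, ∀ q ∈ ps, (shift l q.1, shift l' q.2) ∈ i'.graph := by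
  have key : ∀ (as : List Label) (U : Set Label), U.Finite → ∃ l : ℤ, ∀ a ∈ as, shift l a ∉ U := by
    intro as U hU
    have hfin : (⋃ a ∈ {a | a ∈ as}, (fun l => shift l a) ⁻¹' U).Finite :=
      (List.finite_toSet as).biUnion fun a _ => hU.preimage (shift_left_injective a).injOn
    obtain ⟨l, hl⟩ := hfin.exists_notMem
    simp only [Set.mem_iUnion, not_exists] at hl
    exact ⟨l, fun a ha => hl a ha⟩
  obtain ⟨l, hl⟩ := key (ps.map Prod.fst) _ i.finite_usedL
  obtain ⟨l', hl'⟩ := key (ps.map Prod.snd) _ i.finite_usedR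
  have key := FinInj.exists_insert_list
    (ps.map fun q => (shift l q.1, shift l' q.2)) i ?_ ?_ ?_
  · obtain ⟨i', hi', hsub⟩ := key
    exact ⟨i', hi', l, l', fun q hq => hsub (List.mem_map.2 ⟨q, hq, rfl⟩)⟩
  · rw [List.map_map]
    have := h1.map (shift_injective l)
    rwa [List.map_map] at this
  · rw [List.map_map]
    have := h2.map (shift_injective l')
    rwa [List.map_map] at this
  · intro q hq
    obtain ⟨q', hq', rfl⟩ := List.mem_map.1 hq
    exact ⟨hl _ (List.mem_map.2 ⟨q', hq', rfl⟩), hl' _ (List.mem_map.2 ⟨q', hq', rfl⟩)⟩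

namespace Cond

/-- Since (n, l) ≠ (0, 0), the labels v_m^0 and v_{m+n}^{-l} differ, so their partners can be
prescribed independently. -/
theorem exists_start (p : Cond) (b : Bool) {n l : ℤ} (h0 : (n, l) ≠ (0, 0)) (A : Finset Label) :
    ∃ m m' : ZStar, (m' : ℤ) = m + n ∧ m ∉ (p.1 b).usedL ∧ m' ∉ (p.1 b).usedL ∧
      Label.v 0 m ∉ used p.2 b ∧ Label.v 0 m ∉ A ∧
      Label.v (-l) m' ∉ insert (Label.v 0 m) (used p.2 b) := by
  obtain ⟨m₀, hm₀⟩ := exists_translate [0, n] (((p.1 b).finite_usedL.union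
    ((finite_used p.2 b).image subscript)).union (A.finite_toSet.image subscript))
  obtain ⟨m, hm, hmU⟩ := hm₀ 0 (by simp)
  obtain ⟨m', hm', hmU'⟩ := hm₀ n (by simp)
  refine ⟨m, m', by omega, fun h => hmU (.inl (.inl h)), fun h => hmU' (.inl (.inl h)),
    fun h => hmU (.inl (.inr ⟨_, h, rfl⟩)), fun h => hmU (.inr ⟨_, h, rfl⟩), fun h => ?_⟩
  rcases h with h | h
  · injection h with h1 h2
    apply h0
    rw [h2] at hm'
    rw [Prod.mk.injEq]
    omega
  · exact hmU' (.inl (.inr ⟨_, h, rfl⟩))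

/-- Each step uses fresh points: if n ≠ 0, m and m+n receive consecutive values, and v_{m+n}^{-l} is
linked to a fresh start of the next step. The last link has a free target, which is why u' can avoid
A. -/
theorem exists_chain_of_start (A : Finset Label) (c : List (ℤ × ℤ)) : ∀ (n l : ℤ) (p : Cond)
    (b : Bool) (m m' : ZStar), (∀ q ∈ c, q ≠ (0, 0)) → (m' : ℤ) = m + n → m ∉ (p.1 b).usedL →
    m' ∉ (p.1 b).usedL → Label.v (-l) m' ∉ used p.2 b →
    ∃ p' ≥ p, ∃ u' ∉ A, p'.chain b ((n, l) :: c) (.v 0 m) u' := by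
  have line : ∀ (n : ℤ) (p : Cond) (b : Bool) (m m' : ZStar), (m' : ℤ) = m + n →
      m ∉ (p.1 b).usedL → m' ∉ (p.1 b).usedL → ∃ r ≥ p.1, n = 0 ∨ ∃ k k' : ZStar,
        (m, k) ∈ (r b).graph ∧ (m', k') ∈ (r b).graph ∧ (k' : ℤ) = k + 1 := by
    intro n p b m m' hm h1 h2
    rcases eq_or_ne n 0 with rfl | hn
    · exact ⟨p.1, le_rfl, .inl rfl⟩
    obtain ⟨k₀, hk₀⟩ := exists_translate [0, 1] (p.1 b).finite_usedR
    obtain ⟨k, hk, hkU⟩ := hk₀ 0 (by simp)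
    obtain ⟨k', hk', hkU'⟩ := hk₀ 1 (by simp)
    obtain ⟨r, hr, hsub⟩ := FinInj.exists_insert_list [(m, k), (m', k')] (p.1 b)
      (by
        have : m ≠ m' := by rintro rfl; omega
        simpa using this)
      (by
        have : k ≠ k' := by rintro rfl; omega
        simpa using this) (by simp [*])
    refine ⟨Function.update p.1 b r, le_update_self_iff.2 hr, .inr ⟨k, k', ?_, ?_, by omega⟩⟩
    · rw [Function.update_self]; exact hsub (by simp)
    · rw [Function.update_self]; exact hsub (by simp)
  induction c with
  | nil =>
    intro n l p b m m' _ hm h1 h2 h3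
    obtain ⟨r, hr, hk⟩ := line n p b m m' hm h1 h2
    obtain ⟨u', hu'⟩ := ((finite_used p.2 (!b)).union A.finite_toSet).exists_notMem
    obtain ⟨i, hi, hl, -, -⟩ := exists_link p.2 b h3 fun h => hu' (.inl h)
    exact ⟨(r, i), ⟨hr, hi⟩, u', fun h => hu' (.inr h), .cons hm hk hl (.nil _ _)⟩
  | cons q c ih =>
    intro n l p b m m' hc hm h1 h2 h3
    obtain ⟨n₂, l₂⟩ := q
    obtain ⟨r, hr, hk⟩ := line n p b m m' hm h1 h2
    obtain ⟨m₂, m₂', hm₂, h1', h2', h3', -, h4'⟩ :=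
      exists_start (r, p.2) (!b) (hc (n₂, l₂) (by simp)) ∅
    obtain ⟨i, hi, hl, -, hi'⟩ := exists_link p.2 b h3 h3'
    obtain ⟨p', hp', u', hu', hch⟩ := ih n₂ l₂ (r, i) (!b) m₂ m₂'
      (fun q hq => hc q (List.mem_cons_of_mem _ hq)) hm₂ h1' h2' (hi' ▸ h4')
    refine ⟨p', le_trans ⟨hr, hi⟩ hp', u', hu', .cons hm ?_ (link_mono hp'.2 _ _ _ hl) hch⟩
    exact hk.imp_right fun ⟨k, k', hk1, hk2, hk3⟩ =>
      ⟨k, k', (hp'.1 b).1 hk1, (hp'.1 b).1 hk2, hk3⟩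

theorem exists_chain (p : Cond) (b : Bool) (c : List (ℤ × ℤ)) (hc : c ≠ [])
    (hc0 : ∀ q ∈ c, q ≠ (0, 0)) (A : Finset Label) : ∃ p' ≥ p, ∃ u u₀ u' : Label, u ∉ A ∧
      p'.chain b c u u' ∧ link p'.2 b u u₀ ∧ u' ≠ u ∧ u' ≠ u₀ := by
  classical
  obtain ⟨⟨n, l⟩, c, rfl⟩ := List.exists_cons_of_ne_nil hc
  obtain ⟨m, m', hm, h1, h2, h3, hA, h4⟩ := p.exists_start b (hc0 (n, l) (by simp)) A
  -- The partner u₀ of u is fixed in advance, so that the end of the chain can be kept away from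
  -- both.
  obtain ⟨u₀, hu₀⟩ := (finite_used p.2 (!b)).exists_notMem
  obtain ⟨i, hi, hl, hi', -⟩ := exists_link p.2 b h3 hu₀
  obtain ⟨p', hp', u', hu', hch⟩ := exists_chain_of_start {.v 0 m, u₀} c n l ((p.1, i) : Cond) b m m'
    (fun q hq => hc0 q (List.mem_cons_of_mem _ hq)) hm h1 h2 (hi' ▸ h4)
  simp only [Finset.mem_insert, Finset.mem_singleton, not_or] at hu'
  exact ⟨p', le_trans (b := ((p.1, i) : Cond)) ⟨le_rfl, hi⟩ hp', .v 0 m, u₀, u', hA, hch, link_mono hp'.2 _ _ _ hl,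
    hu'.1, hu'.2⟩

end Cond

/-! ### A generic sequence of conditions. -/

/-- A sequence that meets countably many cofinal sets. -/
theorem exists_monotone_meets {P : Type} [Preorder P] (p₀ : P) {ι : Type} [Countable ι]
    (D : ι → Set P) (h : ∀ i p, ∃ q ∈ D i, p ≤ q) :
    ∃ s : ℕ → P, Monotone s ∧ ∀ i, ∃ n, s n ∈ D i := by
  have := Encodable.ofCountable ι
  let 𝒟 : ι → Order.Cofinal P := fun i => ⟨D i, h i⟩
  exact ⟨_, Order.sequenceOfCofinals.monotone p₀ 𝒟, fun i =>
    ⟨_, Order.sequenceOfCofinals.encode_mem p₀ 𝒟 i⟩⟩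

/-- The requirements are indexed by finite data, hence countable in number, and each can be met by
extending any given condition; an increasing sequence meets them all. -/
theorem exists_generic : ∃ s : ℕ → Cond, Monotone s ∧
    (∀ (b : Bool) (κ : List (ZStar × ZStar)), (κ.map Prod.fst).Nodup → (κ.map Prod.snd).Nodup →
      ∀ A : Finset ZStar, ∃ n, ∃ m ∉ A, ∃ k, (m, k) ∈ ((s n).1 b).graph ∧ ∀ q ∈ κ,
        ∃ m' k' : ZStar, (m' : ℤ) = m + q.1 ∧ (k' : ℤ) = k + q.2 ∧
          (m', k') ∈ ((s n).1 b).graph) ∧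
    (∀ ps : List (Label × Label), (ps.map Prod.fst).Nodup → (ps.map Prod.snd).Nodup →
      ∃ n, ∃ l l' : ℤ, ∀ q ∈ ps, (shift l q.1, shift l' q.2) ∈ (s n).2.graph) ∧
    (∀ (b : Bool) (c : List (ℤ × ℤ)), c ≠ [] → (∀ q ∈ c, q ≠ (0, 0)) → ∀ A : Finset Label,
      ∃ n, ∃ u u₀ u' : Label, u ∉ A ∧ (s n).chain b c u u' ∧ Cond.link (s n).2 b u u₀ ∧
        u' ≠ u ∧ u' ≠ u₀) ∧
    (∀ (b : Bool) (A B : Finset ZStar), ∃ n, (∃ a ∉ A, a ∈ ((s n).1 b).resL) ∧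
      ∃ a ∉ B, a ∈ ((s n).1 b).resR) ∧
    (∀ A B : Finset Label, ∃ n, (∃ a ∉ A, a ∈ (s n).2.resL) ∧ ∃ a ∉ B, a ∈ (s n).2.resR) := by
  let D₁ : {t : Bool × List (ZStar × ZStar) × Finset ZStar //
      (t.2.1.map Prod.fst).Nodup ∧ (t.2.1.map Prod.snd).Nodup} → Set Cond := fun t =>
    {p | ∃ m ∉ t.1.2.2, ∃ k, (m, k) ∈ (p.1 t.1.1).graph ∧ ∀ q ∈ t.1.2.1,
        ∃ m' k' : ZStar, (m' : ℤ) = m + q.1 ∧ (k' : ℤ) = k + q.2 ∧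
          (m', k') ∈ (p.1 t.1.1).graph}
  let D₂ : {ps : List (Label × Label) // (ps.map Prod.fst).Nodup ∧ (ps.map Prod.snd).Nodup} →
      Set Cond := fun t =>
    {p | ∃ l l' : ℤ, ∀ q ∈ t.1, (shift l q.1, shift l' q.2) ∈ p.2.graph}
  let D₃ : {t : Bool × List (ℤ × ℤ) × Finset Label //
      t.2.1 ≠ [] ∧ ∀ q ∈ t.2.1, q ≠ (0, 0)} → Set Cond := fun t =>
    {p | ∃ u u₀ u' : Label, u ∉ t.1.2.2 ∧ p.chain t.1.1 t.1.2.1 u u' ∧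
      Cond.link p.2 t.1.1 u u₀ ∧ u' ≠ u ∧ u' ≠ u₀}
  let D₄ : Bool × Finset ZStar × Finset ZStar → Set Cond := fun t =>
    {p | (∃ a ∉ t.2.1, a ∈ (p.1 t.1).resL) ∧ ∃ a ∉ t.2.2, a ∈ (p.1 t.1).resR}
  let D₅ : Finset Label × Finset Label → Set Cond := fun t =>
    {p | (∃ a ∉ t.1, a ∈ p.2.resL) ∧ ∃ a ∉ t.2, a ∈ p.2.resR}
  have key := exists_monotone_meets (P := Cond) (fun _ => .empty, .empty)
    (Sum.elim D₁ (Sum.elim D₂ (Sum.elim D₃ (Sum.elim D₄ D₅)))) ?_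
  · obtain ⟨s, hs, h⟩ := key
    refine ⟨s, hs, fun b κ h1 h2 A => h (.inl ⟨(b, κ, A), h1, h2⟩),
      fun ps h1 h2 => h (.inr (.inl ⟨ps, h1, h2⟩)),
      fun b c h1 h2 A => h (.inr (.inr (.inl ⟨(b, c, A), h1, h2⟩))),
      fun b A B => h (.inr (.inr (.inr (.inl (b, A, B))))),
      fun A B => h (.inr (.inr (.inr (.inr (A, B)))))⟩
  · rintro (⟨⟨b, κ, A⟩, h1, h2⟩ | ⟨ps, h1, h2⟩ | ⟨⟨b, c, A⟩, h1, h2⟩ | ⟨b, A, B⟩ | ⟨A, B⟩) p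
    · obtain ⟨r, hr, m, hm, k, hk, h⟩ := exists_translate_lists κ h1 h2 (p.1 b) A
      refine ⟨(Function.update p.1 b r, p.2), ⟨m, hm, k, ?_⟩, le_update_self_iff.2 hr, le_rfl⟩
      simp only [Function.update_self]
      exact ⟨hk, h⟩
    · obtain ⟨i, hi, h⟩ := exists_shift_lists ps h1 h2 p.2
      exact ⟨(p.1, i), h, le_rfl, hi⟩
    · obtain ⟨p', hp', h⟩ := p.exists_chain b c h1 h2 A
      exact ⟨p', h, hp'⟩
    · obtain ⟨r, hr, h⟩ := (p.1 b).exists_reserve A B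
      refine ⟨(Function.update p.1 b r, p.2), ?_, le_update_self_iff.2 hr, le_rfl⟩
      simpa [D₄] using h
    · obtain ⟨i, hi, h⟩ := p.2.exists_reserve A B
      exact ⟨(p.1, i), h, le_rfl, hi⟩


/-! ### The groups G as amalgams, and their isomorphism classes. -/

/-- The labels correspond to the elements of `S`. -/
noncomputable def labelEquiv (ρ θ : Equiv.Perm ZStar) : Label ≃ S ρ θ :=
  Equiv.ofInjective (gen ρ θ) (gen_injective ρ θ)

theorem labelEquiv_apply (ρ θ : Equiv.Perm ZStar) (a : Label) :
    labelEquiv ρ θ a = genS ρ θ a := rfl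

namespace Param

/-- The permutations `ρ` and `ρ̃`. -/
def rho (ω : Param) : Bool → Equiv.Perm ZStar
  | false => ω.ρ
  | true => ω.ρt

/-- The permutations `θ` and `θ̃`. -/
def theta (ω : Param) : Bool → Equiv.Perm ZStar
  | false => ω.θ
  | true => ω.θt

/-- The effect of `ι` on labels. -/
noncomputable def iotaLabel (ω : Param) : Label ≃ Label :=
  ((labelEquiv ω.ρ ω.θ).trans ω.ι).trans (labelEquiv ω.ρt ω.θt).symm

theorem genS_iotaLabel (ω : Param) (a : Label) :
    genS ω.ρt ω.θt (ω.iotaLabel a) = ω.ι (genS ω.ρ ω.θ a) := by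
  rw [← labelEquiv_apply, ← labelEquiv_apply]
  simp [iotaLabel]

theorem iotaLabel_eq (ω : Param) {a b : Label} (h : ω.ι (genS ω.ρ ω.θ a) = genS ω.ρt ω.θt b) :
    ω.iotaLabel a = b := by
  rw [← genS_iotaLabel, ← labelEquiv_apply, ← labelEquiv_apply] at h
  exact (labelEquiv ω.ρt ω.θt).injective h

/-- The effect of `ι` and of its inverse on labels. -/
noncomputable def transfer (ω : Param) : Bool → Label ≃ Label
  | false => ω.iotaLabel
  | true => ω.iotaLabel.symm

/-- The embeddings of the two factors. -/
noncomputable def incl (ω : Param) (b : Bool) : F →* G ω := Monoid.PushoutI.of (φ := edgeMap ω) b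

theorem incl_injective (ω : Param) (b : Bool) : Function.Injective (ω.incl b) := by
  refine Monoid.PushoutI.of_injective (φ := edgeMap ω) (fun i => ?_) b
  cases i
  · exact Subtype.val_injective
  · exact Subtype.val_injective.comp (edgeIso ω).injective

theorem incl_iota (ω : Param) (s : S ω.ρ ω.θ) : ω.incl false s = ω.incl true (ω.ι s) := by
  have h1 := Monoid.PushoutI.of_apply_eq_base (edgeMap ω) false
    ⟨s, Subgroup.subset_closure s.2⟩
  have h2 := Monoid.PushoutI.of_apply_eq_base (edgeMap ω) true
    ⟨s, Subgroup.subset_closure s.2⟩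
  rw [← edgeIso_apply]
  exact h1.trans h2.symm

theorem eq_top_of_incl_mem (ω : Param) (N : Subgroup (G ω)) (h : ∀ b f, ω.incl b f ∈ N) :
    N = ⊤ := by
  rw [eq_top_iff]
  rintro g -
  induction g using Monoid.PushoutI.induction_on with
  | of i g => exact h i g
  | base k =>
    rw [← Monoid.PushoutI.of_apply_eq_base (edgeMap ω) false k]
    exact h false _
  | mul a b ha hb => exact N.mul_mem ha hb

theorem isAmalgam (ω : Param) : IsAmalgam ω.rho ω.theta ω.transfer ω.incl where
  injective := ω.incl_injective
  symm_apply b a := by cases b <;> simp [transfer]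
  compat b a := by
    have h : ∀ a, ω.incl false (gen ω.ρ ω.θ a) = ω.incl true (gen ω.ρt ω.θt (ω.iotaLabel a)) :=
      fun a => (ω.incl_iota (genS ω.ρ ω.θ a)).trans (by rw [← genS_iotaLabel]; rfl)
    cases b
    · exact h a
    · have := h (ω.iotaLabel.symm a)
      rw [Equiv.apply_symm_apply] at this
      exact this.symm
  eq_top := ω.eq_top_of_incl_mem

theorem countable_G (ω : Param) : Countable (G ω) := by
  let f : FreeGroup (Bool × Fin 3) →* G ω :=
    FreeGroup.lift fun t => ω.incl t.1 (FreeGroup.of t.2)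
  have hf : f.range = ⊤ := by
    refine ω.eq_top_of_incl_mem _ fun b g => ⟨FreeGroup.map (fun k => (b, k)) g, ?_⟩
    have : f.comp (FreeGroup.map fun k => (b, k)) = ω.incl b := by
      ext k
      simp [f]
    exact DFunLike.congr_fun this g
  exact (MonoidHom.range_eq_top.1 hf).countable

/-- An isomorphism class contains only countably many of the groups obtained by varying `ι`. -/
theorem countable_isomorphic (ρ θ ρt θt : Equiv.Perm ZStar) (Γ : Type) [Group Γ] [Countable Γ] :
    {ι : S ρ θ ≃ S ρt θt | Nonempty (G ⟨ρ, θ, ρt, θt, ι⟩ ≃* Γ)}.Countable := by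
  let ψ : ∀ ι : {ι : S ρ θ ≃ S ρt θt | Nonempty (G ⟨ρ, θ, ρt, θt, ι⟩ ≃* Γ)},
    G ⟨ρ, θ, ρt, θt, ι⟩ ≃* Γ := fun ι => Classical.choice ι.2
  let d : {ι : S ρ θ ≃ S ρt θt | Nonempty (G ⟨ρ, θ, ρt, θt, ι⟩ ≃* Γ)} → Bool × Fin 3 → Γ :=
    fun ι t => ψ ι (incl ⟨ρ, θ, ρt, θt, ι⟩ t.1 (FreeGroup.of t.2))
  -- If two isomorphisms to Γ agree on the six generators, they agree on both factors. Since ι(s) in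
  -- the second factor equals s in the first, ι and ι' then coincide.
  refine Function.Injective.countable (f := d) fun ι ι' h => ?_
  have hincl : ∀ b f, ψ ι (incl ⟨ρ, θ, ρt, θt, ι⟩ b f) = ψ ι' (incl ⟨ρ, θ, ρt, θt, ι'⟩ b f) := by
    intro b
    have : (ψ ι).toMonoidHom.comp (incl ⟨ρ, θ, ρt, θt, ι⟩ b) =
        (ψ ι').toMonoidHom.comp (incl ⟨ρ, θ, ρt, θt, ι'⟩ b) := by
      ext k
      exact congrFun h (b, k)
    exact fun f => DFunLike.congr_fun this f
  refine Subtype.ext (Equiv.ext fun s => Subtype.ext ?_)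
  apply incl_injective ⟨ρ, θ, ρt, θt, ι⟩ true
  apply (ψ ι).injective
  rw [hincl true ((ι' : S ρ θ ≃ S ρt θt) s), ← incl_iota ⟨ρ, θ, ρt, θt, ι⟩ s,
    ← incl_iota ⟨ρ, θ, ρt, θt, ι'⟩ s]
  exact hincl false s

end Param

/-! ### Total extensions and the count. -/

/-- A partial bijection and a bijection between the complements of domain and image give a
bijection. -/
theorem exists_equiv_extends {α β : Type} (f : α ≃. β)
    (e : {a // f a = none} ≃ {b // f.symm b = none}) :
    ∃ E : α ≃ β, (∀ a b, b ∈ f a → E a = b) ∧ ∀ a : {a // f a = none}, E a = e a := by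
  classical
  have hex : ∀ a : {a // ¬ f a = none}, ∃ b : {b // ¬ f.symm b = none}, (b : β) ∈ f a := by
    rintro ⟨a, ha⟩
    obtain ⟨b, hb⟩ := Option.ne_none_iff_exists'.1 ha
    exact ⟨⟨b, fun h => by rw [f.eq_some_iff.2 hb] at h; simp at h⟩, hb⟩
  choose g hg using hex
  have hgb : Function.Bijective g := by
    constructor
    · intro a a' h
      have h1 := hg a
      rw [h] at h1
      exact Subtype.ext (f.inj h1 (hg a'))
    · rintro ⟨b, hb⟩
      obtain ⟨a, ha⟩ := Option.ne_none_iff_exists'.1 hb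
      have ha' : b ∈ f a := f.eq_some_iff.1 ha
      have hne : ¬ f a = none := fun h => by rw [h] at ha'; simp at ha'
      exact ⟨⟨a, hne⟩, Subtype.ext (Option.mem_unique (hg ⟨a, hne⟩) ha')⟩
  let E : α ≃ β := (Equiv.sumCompl fun a => f a = none).symm.trans
    ((Equiv.sumCongr e (Equiv.ofBijective g hgb)).trans (Equiv.sumCompl fun b => f.symm b = none))
  refine ⟨E, fun a b hb => ?_, fun a => ?_⟩
  · have hne : ¬ f a = none := fun h => by rw [h] at hb; simp at hb
    have h0 := Equiv.sumCompl_symm_apply_of_neg (p := fun a => f a = none) hne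
    have : E a = g ⟨a, hne⟩ := by
      simp only [E, Equiv.trans_apply, h0]
      rfl
    rw [this]
    exact Option.mem_unique (hg ⟨a, hne⟩) hb
  · simp [E]

theorem CoInfinite.nonempty_equiv {α β : Type} {f : α ≃. β} (hf : CoInfinite f) :
    Nonempty ({a // f a = none} ≃ {b // f.symm b = none}) := by
  have := hf.1.1.to_subtype
  have := hf.1.2.to_subtype
  have := hf.2.1.to_subtype
  have := hf.2.2.to_subtype
  exact nonempty_equiv_of_countable (α := {a | f a = none}) (β := {b | f.symm b = none})

/-- The complements of domain and image are matched through any permutation of an enumeration, and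
distinct permutations give distinct extensions. -/
theorem CoInfinite.exists_family {α β : Type} {f : α ≃. β} (hf : CoInfinite f) :
    ∃ E : Equiv.Perm ℕ → (α ≃ β), Function.Injective E ∧ ∀ π a b, b ∈ f a → E π a = b := by
  obtain ⟨e⟩ := hf.nonempty_equiv
  have := hf.1.1.to_subtype
  have := hf.1.2.to_subtype
  obtain ⟨e₁⟩ : Nonempty (ℕ ≃ {a // f a = none}) :=
    nonempty_equiv_of_countable (β := {a | f a = none})
  choose E hE hE' using fun π : Equiv.Perm ℕ =>
    exists_equiv_extends f ((e₁.symm.trans π).trans (e₁.trans e))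
  refine ⟨E, fun π π' h => Equiv.ext fun n => ?_, hE⟩
  have h1 := hE' π (e₁ n)
  rw [h, hE' π' (e₁ n)] at h1
  simpa using (Subtype.ext h1).symm

/-- One representative is taken from each class: fewer than 2^ℵ₀ countable classes could not cover
X. -/
theorem exists_pairwise_not_rel {X : Type} (hX : Cardinal.mk X = 2 ^ Cardinal.aleph0)
    (s : Setoid X) (h : ∀ x, {y | s y x}.Countable) :
    ∃ A : Set X, Cardinal.mk A = 2 ^ Cardinal.aleph0 ∧ A.Pairwise fun x y => ¬ s x y := by
  refine ⟨Set.range (Quotient.out : Quotient s → X), ?_, ?_⟩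
  · rw [Cardinal.mk_range_eq _ Quotient.out_injective]
    apply le_antisymm
    · rw [← hX]
      exact Cardinal.mk_le_of_surjective Quotient.mk_surjective
    · by_contra! hlt
      have h1 : Cardinal.mk X ≤ Cardinal.mk (Quotient s) * Cardinal.aleph0 := by
        refine Cardinal.mk_le_mk_mul_of_mk_preimage_le (Quotient.mk s) fun q => ?_
        obtain ⟨x, rfl⟩ := Quotient.exists_rep q
        have : Quotient.mk s ⁻¹' {Quotient.mk s x} = {y | s y x} := by
          ext y
          simp only [Set.mem_preimage, Set.mem_singleton_iff, Set.mem_ofPred_eq]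
          exact Quotient.eq
        rw [this]
        exact Cardinal.le_aleph0_iff_set_countable.2 (h x)
      rw [hX] at h1
      exact absurd h1 (not_le.2 (Cardinal.mul_lt_of_lt (Cardinal.cantor _).le hlt
        (Cardinal.cantor _)))
  · rintro _ ⟨q, rfl⟩ _ ⟨q', rfl⟩ hne hs
    have := Quotient.sound hs
    rw [Quotient.out_eq, Quotient.out_eq] at this
    exact hne (congrArg _ this)

/-- Every clause is witnessed by finitely many prescribed values, so it persists in all extensions,
whatever θ and θ̃ are. -/
theorem Param.isRich {s : ℕ → Cond} {ω : Param}
    (hr : ∀ n b m k, (m, k) ∈ ((s n).1 b).graph → ω.rho b m = k)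
    (hi : ∀ n a a', (a, a') ∈ (s n).2.graph → ω.iotaLabel a = a')
    (h1 : ∀ (b : Bool) (κ : List (ZStar × ZStar)), (κ.map Prod.fst).Nodup →
      (κ.map Prod.snd).Nodup → ∀ A : Finset ZStar, ∃ n, ∃ m ∉ A, ∃ k,
        (m, k) ∈ ((s n).1 b).graph ∧ ∀ q ∈ κ, ∃ m' k' : ZStar, (m' : ℤ) = m + q.1 ∧
          (k' : ℤ) = k + q.2 ∧ (m', k') ∈ ((s n).1 b).graph)
    (h2 : ∀ ps : List (Label × Label), (ps.map Prod.fst).Nodup → (ps.map Prod.snd).Nodup →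
      ∃ n, ∃ l l' : ℤ, ∀ q ∈ ps, (shift l q.1, shift l' q.2) ∈ (s n).2.graph)
    (h3 : ∀ (b : Bool) (c : List (ℤ × ℤ)), c ≠ [] → (∀ q ∈ c, q ≠ (0, 0)) → ∀ A : Finset Label,
      ∃ n, ∃ u u₀ u' : Label, u ∉ A ∧ (s n).chain b c u u' ∧ Cond.link (s n).2 b u u₀ ∧
        u' ≠ u ∧ u' ≠ u₀) : IsRich ω.rho ω.transfer where
  exists_line b κ hκ hκ' A := by
    obtain ⟨n, m, hm, k, hk, h⟩ := h1 b κ hκ hκ' A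
    refine ⟨m, hm, fun q hq => ?_⟩
    obtain ⟨m', k', hm', hk', hmk⟩ := h q hq
    exact ⟨m', hm', by rw [hr _ _ _ _ hk, hr _ _ _ _ hmk, hk']⟩
  exists_shift ps hps hps' := by
    obtain ⟨n, l, l', h⟩ := h2 ps hps hps'
    exact ⟨l, l', fun q hq => hi _ _ _ (h q hq)⟩
  exists_chain b c hc hc0 A := by
    have hlink : ∀ n b a a', Cond.link (s n).2 b a a' → ω.transfer b a = a' := by
      intro n b a a' h
      cases b
      · exact hi _ _ _ h
      · exact (Equiv.symm_apply_eq _).2 (hi _ _ _ h).symm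
    obtain ⟨n, u, u₀, u', hu, hch, hl, hne, hne'⟩ := h3 b c hc hc0 A
    exact ⟨u, u', hu, hch.mono (fun b m k => hr n b m k) (hlink n), hne,
      (hlink n b u u₀ hl).symm ▸ hne'⟩

/-- Partial bijections all of whose extensions give simple groups. -/
theorem exists_forall_isSimpleGroup : ∃ (r rt : ZStar ≃. ZStar) (i : Label ≃. Label),
    (CoInfinite r ∧ CoInfinite rt ∧ CoInfinite i) ∧
      ∀ ω : Param, ω.Extends r rt i → IsSimpleGroup (G ω) := by
  obtain ⟨s, hs, h1, h2, h3, h4, h5⟩ := exists_generic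
  have hsb : ∀ b, Monotone fun n => (s n).1 b := fun b n n' h => (hs h).1 b
  have hs2 : Monotone fun n => (s n).2 := fun n n' h => (hs h).2
  obtain ⟨r, hr⟩ := FinInj.exists_pequiv (hsb false)
  obtain ⟨rt, hrt⟩ := FinInj.exists_pequiv (hsb true)
  obtain ⟨i, hi⟩ := FinInj.exists_pequiv hs2
  refine ⟨r, rt, i, ⟨?_, ?_, ?_⟩, fun ω hω => ?_⟩
  · exact FinInj.coInfinite (hsb false) hr (fun A => (h4 false A A).imp fun _ h => h.1)
      fun A => (h4 false A A).imp fun _ h => h.2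
  · exact FinInj.coInfinite (hsb true) hrt (fun A => (h4 true A A).imp fun _ h => h.1)
      fun A => (h4 true A A).imp fun _ h => h.2
  · exact FinInj.coInfinite hs2 hi (fun A => (h5 A A).imp fun _ h => h.1)
      fun A => (h5 A A).imp fun _ h => h.2
  · refine isSimpleGroup_of_isRich (Param.isRich (s := s) ?_ ?_ h1 h2 h3) ω.isAmalgam
    · intro n b m k h
      cases b
      · exact hω.1 m k ((hr m k).2 ⟨n, h⟩)
      · exact hω.2.1 m k ((hrt m k).2 ⟨n, h⟩)
    · intro n a a' h
      exact ω.iotaLabel_eq (hω.2.2 a a' ((hi a a').2 ⟨n, h⟩))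

/-- Varying `ι` gives continuum many pairwise non-isomorphic groups. -/
theorem exists_pairwise_isEmpty_mulEquiv {r rt : ZStar ≃. ZStar} {i : Label ≃. Label}
    (hr : CoInfinite r) (hrt : CoInfinite rt) (hi : CoInfinite i) :
    ∃ A : Set Param, Cardinal.mk A = 2 ^ Cardinal.aleph0 ∧ (∀ ω ∈ A, ω.Extends r rt i) ∧
      A.Pairwise fun ω ω' => IsEmpty (G ω ≃* G ω') := by
  obtain ⟨ρ, hρ, -⟩ := exists_equiv_extends r hr.nonempty_equiv.some
  obtain ⟨ρt, hρt, -⟩ := exists_equiv_extends rt hrt.nonempty_equiv.some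
  obtain ⟨E, hE, hEi⟩ := hi.exists_family
  -- Only ι varies; θ and θ̃ are unconstrained and are taken to be the identity.
  let ι : Equiv.Perm ℕ → (S ρ 1 ≃ S ρt 1) := fun π =>
    ((labelEquiv ρ 1).symm.trans (E π)).trans (labelEquiv ρt 1)
  have hι : Function.Injective ι := by
    intro π π' h
    refine hE (Equiv.ext fun a => ?_)
    have := DFunLike.congr_fun h (labelEquiv ρ 1 a)
    simpa [ι] using this
  let ω : Equiv.Perm ℕ → Param := fun π => ⟨ρ, 1, ρt, 1, ι π⟩
  have hω : Function.Injective ω := by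
    intro π π' h
    injection h with _ _ _ _ h
    exact hι h
  have hext : ∀ π, (ω π).Extends r rt i := by
    refine fun π => ⟨hρ, hρt, fun a b hab => ?_⟩
    change ι π (labelEquiv ρ 1 a) = labelEquiv ρt 1 b
    simp [ι, hEi π a b hab]
  let s : Setoid (Equiv.Perm ℕ) :=
    { r := fun π π' => Nonempty (G (ω π) ≃* G (ω π'))
      iseqv := ⟨fun π => ⟨MulEquiv.refl _⟩, fun ⟨e⟩ => ⟨e.symm⟩, fun ⟨e⟩ ⟨e'⟩ => ⟨e.trans e'⟩⟩ }
  obtain ⟨A, hA, hpair⟩ := exists_pairwise_not_rel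
    (by rw [Cardinal.mk_perm_eq_two_power, Cardinal.mk_nat]) s fun π =>
      have := (ω π).countable_G
      (Param.countable_isomorphic ρ 1 ρt 1 (G (ω π))).preimage hι
  refine ⟨ω '' A, (Cardinal.mk_image_eq hω).trans hA, ?_, ?_⟩
  · rintro _ ⟨π, -, rfl⟩
    exact hext π
  · rintro _ ⟨π, hπ, rfl⟩ _ ⟨π', hπ', rfl⟩ hne
    exact not_nonempty_iff.1 (hpair hπ hπ' fun h => hne (congrArg ω h))

end CammGroups

theorem propositionp :
    ∃ (r rt : CammGroups.ZStar ≃. CammGroups.ZStar)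
      (i : CammGroups.Label ≃. CammGroups.Label),
      (CammGroups.CoInfinite r ∧ CammGroups.CoInfinite rt ∧ CammGroups.CoInfinite i) ∧
      (∀ ω : CammGroups.Param, ω.Extends r rt i → IsSimpleGroup (CammGroups.G ω)) ∧
      ∃ A : Set CammGroups.Param,
        Cardinal.mk A = 2 ^ Cardinal.aleph0 ∧
        (∀ ω ∈ A, ω.Extends r rt i ∧ IsSimpleGroup (CammGroups.G ω)) ∧
        A.Pairwise fun ω ω' => IsEmpty (CammGroups.G ω ≃* CammGroups.G ω') := by
  obtain ⟨r, rt, i, ⟨hr, hrt, hi⟩, hsimple⟩ := CammGroups.exists_forall_isSimpleGroup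
  obtain ⟨A, hA, hext, hpair⟩ := CammGroups.exists_pairwise_isEmpty_mulEquiv hr hrt hi
  exact ⟨r, rt, i, ⟨hr, hrt, hi⟩, hsimple, A, hA, fun ω hω => ⟨hext ω hω, hsimple ω (hext ω hω)⟩,
    hpair⟩
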